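/- **Setting.** For $\alpha\in(0,2]$ and $\sigma>0$, a real random variable $X$ has the symmetric stable law $S_\alpha(\sigma)$ if $\mathbb E[e^{itX}]=e^{-\sigma^\alpha|t|^\alpha}$ for all $t\in\mathbb R$. Put $C_\alpha=\frac{2}{\pi}\Gamma(\alpha)\sin\left(\frac{\alpha\pi}{2}\right)$. Write $f\simeq g$ (as $z\to+\infty$ or $z\to-\infty$) if $f(z)/g(z)\to1$. A function $U$ is regularly varying of index $\rho$ if $U(yt)/U(t)\to y^\rho$ as $t\to+\infty$ for every $y>0$. For continuous $\tau:\mathbb R\to\mathbb R$ write: * $\tau\in E_1$ with exponent $\beta$ if $0\le\beta<1$ and $|\tau(z)|=O(|z|^\beta)$ as $z\to\pm\infty$; * $\tau\in E_2$ with exponent $\gamma$ if $\gamma>0$, $|\tau(z)|\simeq|z|^\gamma$ as $z\to+\infty$ and as $z\to-\infty$, and for some $a>0$ the function $\tau$ is strictly increasing on $\{|z|>a\}$; * $\tau\in E_3$ with exponent $\gamma$ if $\gamma>0$, $\tau(z)\simeq z^\gamma$ as $z\to+\infty$, $|\tau(z)|=O(|z|^\beta)$ as $z\to-\infty$ for some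 $\beta<\gamma$, and for some $a>0$ the function $\tau$ is strictly increasing on $\{z>a\}$. **Theorem (tail behaviour of $|X\tau(Y)|$).** Let $X\sim S_{\alpha_x}(\sigma_x)$ and $Y\sim S_{\alpha_y}(\sigma_y)$ be independent, with $\alpha_x,\alpha_y\in(0,2]$ and $\sigma_x,\sigma_y>0$. 1. Let $\tau\in E_1$ with exponent $\beta$, $\tau\not\equiv0$, $\beta\alpha_x<\alpha_y$ and $\alpha_x<2$. Then $\mathbb E|\tau(Y)|^{\alpha_x}<\infty$ and, as $t\to+\infty$, $$\mathbb P(|X\tau(Y)|>t)\simeq C_{\alpha_x}\sigma_x^{\alpha_x}\,\mathbb E\left[|\tau(Y)|^{\alpha_x}\right]t^{-\alpha_x}.$$ 2. Let $\tau\in E_2\cup E_3$ with exponent $\gamma$, put $\underline\alpha=\min(\alpha_x,\alpha_y/\gamma)$, and let $c_\tau=\frac12$ if $\tau\in E_3$ and $c_\tau=1$ otherwise. In each of the following cases the function $z\mapsto\mathbb P(|X\tau(Y)|>z)$ is regularly varying of index $-\underline\alpha$, and as $z\to+\infty$: * if $\gamma>\alpha_y/\alpha_x$ and $\alpha_y<2$,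 then $\mathbb E|X|^{\underline\alpha}<\infty$ and $$\mathbb P(|X\tau(Y)|>z)\simeq c_\tau C_{\underline\alpha\gamma}\,\sigma_y^{\underline\alpha\gamma}\,\mathbb E\left[|X|^{\underline\alpha}\right]z^{-\underline\alpha};$$ * if $\gamma=\alpha_y/\alpha_x$, $\alpha_x<2$ and $\alpha_y<2$, then $$\mathbb P(|X\tau(Y)|>z)\simeq c_\tau\,\underline\alpha\,C_{\underline\alpha}C_{\underline\alpha\gamma}\,\sigma_x^{\underline\alpha}\sigma_y^{\underline\alpha\gamma}\,z^{-\underline\alpha}\log z;$$ * if $\gamma<\alpha_y/\alpha_x$ and $\alpha_x<2$, then $\mathbb E|\tau(Y)|^{\underline\alpha}<\infty$ and $$\mathbb P(|X\tau(Y)|>z)\simeq C_{\underline\alpha}\,\sigma_x^{\underline\alpha}\,\mathbb E\left[|\tau(Y)|^{\underline\alpha}\right]z^{-\underline\alpha}.$$ -/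

import Mathlib

open MeasureTheory ProbabilityTheory Filter Topology Asymptotics

noncomputable section

namespace StableTail

/-- `X ∼ S_α(σ)` under `P`: the real random variable `X` has the symmetric stable law with
stability `α ∈ (0, 2]` and scale `σ > 0`, i.e. its characteristic function is
`t ↦ exp (-σ ^ α * |t| ^ α)`. -/
structure IsSymmStable {Ω : Type*} [MeasurableSpace Ω] (P : Measure Ω) (X : Ω → ℝ)
    (α σ : ℝ) : Prop where
  measurable : Measurable X
  index_pos : 0 < α
  index_le_two : α ≤ 2
  scale_pos : 0 < σ
  charFun_eq : ∀ t : ℝ,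
    charFun (P.map X) t = ((Real.exp (-(σ ^ α * |t| ^ α)) : ℝ) : ℂ)

/-- The constant `C_α = (2 / π) Γ(α) sin (α π / 2)`. -/
def tailConst (α : ℝ) : ℝ :=
  2 / Real.pi * Real.Gamma α * Real.sin (α * (Real.pi / 2))

/-- The survival function `z ↦ P(Z > z)`. -/
def survival {Ω : Type*} [MeasurableSpace Ω] (P : Measure Ω) (Z : Ω → ℝ) (z : ℝ) : ℝ :=
  P.real {ω | z < Z ω}

/-- `f ≃ g` along `l`: the quotient `f / g` tends to `1`. -/
def AsympEq (l : Filter ℝ) (f g : ℝ → ℝ) : Prop :=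
  Tendsto (fun z => f z / g z) l (𝓝 1)

/-- `U` is regularly varying at `+∞` with exponent `ρ`. -/
def RegularlyVarying (U : ℝ → ℝ) (ρ : ℝ) : Prop :=
  ∀ y : ℝ, 0 < y → Tendsto (fun t => U (y * t) / U t) atTop (𝓝 (y ^ ρ))

/-- The activation functions in `E₁` with growth exponent `β ∈ [0, 1)`. -/
def E1 (β : ℝ) : Set (ℝ → ℝ) :=
  {τ | Continuous τ ∧ 0 ≤ β ∧ β < 1 ∧
    (fun z => |τ z|) =O[atTop] (fun z => |z| ^ β) ∧
    (fun z => |τ z|) =O[atBot] (fun z => |z| ^ β)}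

/-- The activation functions in `E₂` with growth exponent `γ > 0`. -/
def E2 (γ : ℝ) : Set (ℝ → ℝ) :=
  {τ | Continuous τ ∧ 0 < γ ∧
    AsympEq atTop (fun z => |τ z|) (fun z => |z| ^ γ) ∧
    AsympEq atBot (fun z => |τ z|) (fun z => |z| ^ γ) ∧
    ∃ a : ℝ, 0 < a ∧ StrictMonoOn τ {z | a < |z|}}

/-- The activation functions in `E₃` with growth exponent `γ > 0` at `+∞`. -/
def E3 (γ : ℝ) : Set (ℝ → ℝ) :=
  {τ | Continuous τ ∧ 0 < γ ∧
    AsympEq atTop τ (fun z => z ^ γ) ∧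
    (∃ β : ℝ, β < γ ∧ (fun z => |τ z|) =O[atBot] (fun z => |z| ^ β)) ∧
    ∃ a : ℝ, 0 < a ∧ StrictMonoOn τ {z | a < z}}

open Classical in
/-- The constant `c_τ`: it is `1 / 2` if `τ ∈ E₃` and `1` otherwise. -/
def cTau (γ : ℝ) (τ : ℝ → ℝ) : ℝ := if τ ∈ E3 γ then 1 / 2 else 1

end StableTail

end

namespace StableTail

open Set

/-! The theorem rests on the tail of a single stable variable and on two facts about products of
independent variables with power tails.

Tail of a stable law, `α < 2`. The law of `X / r`, multiplied by `r ^ α`, should converge away from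
0 to a multiple of `|x| ^ (-1 - α) dx`. That measure is infinite near 0, so both sides are weighted
by `k(x) = 1 - exp (-x ^ 2 / 2)`. Since `exp (-x ^ 2 / 2)` is the characteristic function of a
standard Gaussian `G`, weighting a law with characteristic function `φ` turns its transform into
`E[φ(t) - φ(t + G)]`. For `X / r`, times `r ^ α`, this tends to `σ ^ α E[|t + G| ^ α - |t| ^ α]`,
which up to a constant is the transform of `k(x) |x| ^ (-1 - α)`. Lévy's continuity theorem gives
weak convergence after normalisation, and testing with ramp functions divided by `k` yields `r ^ α
P(X > r) → C_α σ ^ α / 2` (`tendsto_rpow_mul_tail`). The constant comes from `∫ (1 - cos x) x ^ (-1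
- α) dx = 1 / (α C_α)` over `(0, ∞)`.

Products. With `g(s) = s ^ a P(W > s)`, independence gives `z ^ a P(W V > z) = E[V ^ a g(z / V)]`.
If `E V ^ a` is finite, dominated convergence is Breiman's lemma
(`tendsto_survival_mul_of_integrable`): the heavier factor dictates the tail. If both tails have
index `a`, the moment of `V` truncated at `z` grows like `log z`, whence the logarithm
(`tendsto_survival_mul_div_log`).

A growth exponent `γ` gives `|τ(Y)|` the tail index `αy / γ` when `αy < 2`
(`tendsto_survival_abs_comp`), and the cases of the theorem compare it with `αx`. The limits must be
nonzero to give equivalents; for `E |τ(Y)| ^ αx` this holds because a stable law charges every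
nonempty open set (`stable_isOpenPosMeasure`). -/

/-! ### The constant `C_α` and the integral representation of `|u| ^ α`. -/

/-- The Bochner integral of a non-integrable function is 0 by convention, so a nonzero value
certifies integrability. -/
lemma lintegral_ofReal_eq_of_integral_eq {μ : Measure ℝ} {f : ℝ → ℝ} {v : ℝ}
    (hf : 0 ≤ᵐ[μ] f) (h : ∫ x, f x ∂μ = v) (hv : v ≠ 0) :
    ∫⁻ x, ENNReal.ofReal (f x) ∂μ = ENNReal.ofReal v := by
  rw [← ofReal_integral_eq_lintegral_ofReal (Integrable.of_integral_ne_zero (h ▸ hv)) hf, h]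

lemma integral_one_sub_cos_mul_exp_neg {s : ℝ} (hs : 0 < s) :
    ∫ x in Ioi (0 : ℝ), (1 - Real.cos x) * Real.exp (-(s * x)) = 1 / (s * (1 + s ^ 2)) := by
  -- An explicit antiderivative vanishing at infinity, so the integral is `-F 0`; integrability is
  -- free because the integrand is nonnegative.
  set F : ℝ → ℝ := fun x => Real.exp (-(s * x)) *
    (-(1 / s) - (Real.sin x - s * Real.cos x) / (1 + s ^ 2)) with hF
  have hs2 : (1 + s ^ 2) ≠ 0 := by positivity
  have hderiv : ∀ x, HasDerivAt F ((1 - Real.cos x) * Real.exp (-(s * x))) x := by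
    intro x
    have h1 : HasDerivAt (fun x => Real.exp (-(s * x))) (Real.exp (-(s * x)) * (-(s * 1))) x :=
      (((hasDerivAt_id x).const_mul s).neg).exp
    have h2 : HasDerivAt (fun x => -(1 / s) - (Real.sin x - s * Real.cos x) / (1 + s ^ 2))
        (-((Real.cos x - s * (-Real.sin x)) / (1 + s ^ 2))) x :=
      (((Real.hasDerivAt_sin x).sub ((Real.hasDerivAt_cos x).const_mul s)).div_const _).const_sub _
    refine (h1.mul h2).congr_deriv ?_
    field_simp
    ring
  have hlim : Tendsto F atTop (𝓝 0) := by
    have h1 : Tendsto (fun x => Real.exp (-(s * x))) atTop (𝓝 0) :=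
      Real.tendsto_exp_neg_atTop_nhds_zero.comp (tendsto_id.const_mul_atTop hs)
    refine h1.zero_mul_isBoundedUnder_le ?_
    refine isBoundedUnder_of ⟨1 / s + (1 + s), fun x => ?_⟩
    simp only [Function.comp, Real.norm_eq_abs]
    have hb : |(Real.sin x - s * Real.cos x) / (1 + s ^ 2)| ≤ 1 + s := by
      rw [abs_div, abs_of_pos (by positivity : 0 < 1 + s ^ 2)]
      refine (div_le_self (abs_nonneg _) (by nlinarith)).trans ?_
      refine (abs_sub _ _).trans ?_
      rw [abs_mul, abs_of_pos hs]
      nlinarith [Real.abs_sin_le_one x, Real.abs_cos_le_one x, abs_nonneg (Real.cos x)]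
    refine (abs_sub _ _).trans ?_
    rw [abs_neg, abs_of_pos (by positivity : 0 < 1 / s)]
    linarith
  rw [integral_Ioi_of_hasDerivAt_of_nonneg' (fun x _ => hderiv x) (fun x _ => by
    have := Real.cos_le_one x
    have : 0 ≤ 1 - Real.cos x := by linarith
    positivity) hlim]
  simp [hF]
  field_simp
  ring

lemma lintegral_swap_Ioi {f : ℝ → ℝ → ENNReal} (hf : Measurable (Function.uncurry f)) :
    ∫⁻ x in Ioi (0 : ℝ), ∫⁻ s in Ioi (0 : ℝ), f x s =
      ∫⁻ s in Ioi (0 : ℝ), ∫⁻ x in Ioi (0 : ℝ), f x s :=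
  lintegral_lintegral_swap hf.aemeasurable

lemma sin_pos_of_index {α : ℝ} (h0 : 0 < α) (h2 : α < 2) : 0 < Real.sin (α * (Real.pi / 2)) :=
  Real.sin_pos_of_pos_of_lt_pi (by positivity) (by nlinarith [Real.pi_pos])

/-- Write `1 / (1 + s ^ 2)` as `∫ exp (-(1 + s ^ 2) r) dr` and swap. The two integrations produce
`Γ(α/2) Γ(1 - α/2) / 2`, and Euler's reflection formula concludes. -/
lemma lintegral_rpow_div_one_add_sq {α : ℝ} (h0 : 0 < α) (h2 : α < 2) :
    ∫⁻ s in Ioi (0 : ℝ), ENNReal.ofReal (s ^ (α - 1) / (1 + s ^ 2)) =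
      ENNReal.ofReal (Real.pi / (2 * Real.sin (α * (Real.pi / 2)))) := by
  have hG : 0 < Real.Gamma (α / 2) := Real.Gamma_pos_of_pos (by linarith)
  have hG' : 0 < Real.Gamma (1 - α / 2) := Real.Gamma_pos_of_pos (by linarith)
  have h1 : ∀ s ∈ Ioi (0 : ℝ), ENNReal.ofReal (s ^ (α - 1) / (1 + s ^ 2)) =
      ∫⁻ r in Ioi (0 : ℝ), ENNReal.ofReal (s ^ (α - 1) * Real.exp (-((1 + s ^ 2) * r))) := by
    intro s (hs : 0 < s)
    refine (lintegral_ofReal_eq_of_integral_eq ?_ ?_ (by positivity)).symm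
    · exact Eventually.of_forall fun r => by positivity
    · have := Real.integral_rpow_mul_exp_neg_mul_Ioi (a := 1) (r := 1 + s ^ 2) one_pos
        (by positivity)
      simp only [sub_self, Real.rpow_zero, one_mul, Real.rpow_one, Real.Gamma_one, mul_one] at this
      rw [integral_const_mul, this]
      ring
  have h3 : ∀ r ∈ Ioi (0 : ℝ),
      ∫⁻ s in Ioi (0 : ℝ), ENNReal.ofReal (s ^ (α - 1) * Real.exp (-((1 + s ^ 2) * r))) =
      ENNReal.ofReal (1 / 2 * Real.Gamma (α / 2) *
        (r ^ ((1 - α / 2) - 1) * Real.exp (-(1 * r)))) := by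
    intro r (hr : 0 < r)
    refine lintegral_ofReal_eq_of_integral_eq ?_ ?_ (by positivity)
    · filter_upwards [ae_restrict_mem measurableSet_Ioi] with s (hs : 0 < s)
      simp only [Pi.zero_apply]
      positivity
    · have := integral_rpow_mul_exp_neg_mul_rpow (p := 2) (q := α - 1) (b := r) two_pos
        (by linarith) hr
      have e : ∀ s : ℝ, s ^ (α - 1) * Real.exp (-((1 + s ^ 2) * r)) =
          Real.exp (-(1 * r)) * (s ^ (α - 1) * Real.exp (-r * s ^ (2 : ℝ))) := by
        intro s
        rw [Real.rpow_two, mul_left_comm, ← Real.exp_add]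
        ring_nf
      simp_rw [e]
      rw [integral_const_mul, this]
      ring_nf
  rw [setLIntegral_congr_fun measurableSet_Ioi h1, lintegral_swap_Ioi (by fun_prop),
    setLIntegral_congr_fun measurableSet_Ioi h3]
  refine lintegral_ofReal_eq_of_integral_eq ?_ ?_ ?_
  · filter_upwards [ae_restrict_mem measurableSet_Ioi] with s (hs : 0 < s)
    simp only [Pi.zero_apply]
    positivity
  · rw [integral_const_mul, Real.integral_rpow_mul_exp_neg_mul_Ioi (by linarith) one_pos]
    have := Real.Gamma_mul_Gamma_one_sub (α / 2)
    simp only [ne_eq, one_ne_zero, not_false_eq_true, div_self, Real.one_rpow, one_mul]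
    rw [mul_assoc, this, show Real.pi * (α / 2) = α * (Real.pi / 2) by ring]
    field_simp
  · have := sin_pos_of_index h0 h2
    positivity

lemma tailConst_pos {α : ℝ} (h0 : 0 < α) (h2 : α < 2) : 0 < tailConst α := by
  have := sin_pos_of_index h0 h2
  have := Real.Gamma_pos_of_pos h0
  unfold tailConst
  positivity

/-- Expand `x ^ (-1 - α)` as `Γ(1 + α)⁻¹ ∫ s ^ α exp (-s x) ds` and swap by Tonelli; the inner
integral in `x` is elementary and leaves `s ^ (α - 1) / (1 + s ^ 2)`. -/
lemma lintegral_one_sub_cos_mul_rpow {α : ℝ} (h0 : 0 < α) (h2 : α < 2) :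
    ∫⁻ x in Ioi (0 : ℝ), ENNReal.ofReal ((1 - Real.cos x) * x ^ (-1 - α)) =
      ENNReal.ofReal (1 / (α * tailConst α)) := by
  have hG : 0 < Real.Gamma (1 + α) := Real.Gamma_pos_of_pos (by linarith)
  have hcos : ∀ x : ℝ, 0 ≤ 1 - Real.cos x := fun x => by linarith [Real.cos_le_one x]
  have h1 : ∀ x ∈ Ioi (0 : ℝ), ENNReal.ofReal ((1 - Real.cos x) * x ^ (-1 - α)) =
      ∫⁻ s in Ioi (0 : ℝ), ENNReal.ofReal (1 / Real.Gamma (1 + α)) *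
        ENNReal.ofReal (s ^ α * ((1 - Real.cos x) * Real.exp (-(s * x)))) := by
    intro x (hx : 0 < x)
    have := Real.integral_rpow_mul_exp_neg_mul_Ioi (a := 1 + α) (r := x) (by linarith) hx
    simp_rw [add_sub_cancel_left] at this
    have h := lintegral_ofReal_eq_of_integral_eq ?_ this (by positivity)
    · rw [lintegral_const_mul' _ _ ENNReal.ofReal_ne_top]
      have e : ∀ s : ℝ, ENNReal.ofReal (s ^ α * ((1 - Real.cos x) * Real.exp (-(s * x)))) =
          ENNReal.ofReal (1 - Real.cos x) * ENNReal.ofReal (s ^ α * Real.exp (-(x * s))) := by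
        intro s
        rw [← ENNReal.ofReal_mul (hcos x)]
        ring_nf
      simp_rw [e]
      rw [lintegral_const_mul' _ _ ENNReal.ofReal_ne_top, h, ← ENNReal.ofReal_mul (hcos x),
        ← ENNReal.ofReal_mul (by positivity)]
      congr 1
      rw [one_div x, Real.inv_rpow hx.le, ← Real.rpow_neg hx.le, neg_add, ← sub_eq_add_neg]
      field_simp
    · filter_upwards [ae_restrict_mem measurableSet_Ioi] with s (hs : 0 < s)
      simp only [Pi.zero_apply]
      positivity
  have h3 : ∀ s ∈ Ioi (0 : ℝ), ∫⁻ x in Ioi (0 : ℝ),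
      ENNReal.ofReal (1 / Real.Gamma (1 + α)) *
        ENNReal.ofReal (s ^ α * ((1 - Real.cos x) * Real.exp (-(s * x)))) =
      ENNReal.ofReal (1 / Real.Gamma (1 + α)) *
        ENNReal.ofReal (s ^ (α - 1) / (1 + s ^ 2)) := by
    intro s (hs : 0 < s)
    rw [lintegral_const_mul' _ _ ENNReal.ofReal_ne_top]
    congr 1
    refine lintegral_ofReal_eq_of_integral_eq ?_ ?_ (by positivity)
    · exact Eventually.of_forall fun x => mul_nonneg (by positivity)
        (mul_nonneg (hcos x) (by positivity))
    · rw [integral_const_mul, integral_one_sub_cos_mul_exp_neg hs, Real.rpow_sub_one hs.ne']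
      field_simp
  rw [setLIntegral_congr_fun measurableSet_Ioi h1, lintegral_swap_Ioi (by fun_prop),
    setLIntegral_congr_fun measurableSet_Ioi h3, lintegral_const_mul' _ _ ENNReal.ofReal_ne_top,
    lintegral_rpow_div_one_add_sq h0 h2, ← ENNReal.ofReal_mul (by positivity)]
  congr 1
  have := sin_pos_of_index h0 h2
  have := Real.Gamma_pos_of_pos h0
  rw [add_comm 1 α, Real.Gamma_add_one h0.ne', tailConst]
  field_simp

lemma one_sub_cos_nonneg (x : ℝ) : 0 ≤ 1 - Real.cos x := by linarith [Real.cos_le_one x]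

lemma integral_one_sub_cos_mul_abs_rpow {α : ℝ} (h0 : 0 < α) (h2 : α < 2) :
    ∫ x : ℝ, (1 - Real.cos x) * |x| ^ (-1 - α) = 2 / (α * tailConst α) := by
  have h := integral_comp_abs (f := fun x => (1 - Real.cos x) * x ^ (-1 - α))
  simp only [Real.cos_abs] at h
  have hpos := tailConst_pos h0 h2
  rw [h, integral_eq_lintegral_of_nonneg_ae, lintegral_one_sub_cos_mul_rpow h0 h2,
    ENNReal.toReal_ofReal (by positivity)]
  · ring
  · filter_upwards [ae_restrict_mem measurableSet_Ioi] with s (hs : 0 < s)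
    have := one_sub_cos_nonneg s
    simp only [Pi.zero_apply]
    positivity
  · exact Measurable.aestronglyMeasurable (by fun_prop)

/-- Lévy–Khintchine form of `|u| ^ α`, obtained by scaling from the case `u = 1`. -/
lemma integrable_one_sub_cos_mul_abs_rpow {α : ℝ} (h0 : 0 < α) (h2 : α < 2) (u : ℝ) :
    Integrable (fun x : ℝ => (1 - Real.cos (u * x)) * |x| ^ (-1 - α)) ∧
    ∫ x : ℝ, (1 - Real.cos (u * x)) * |x| ^ (-1 - α) = |u| ^ α * (2 / (α * tailConst α)) := by
  have hpos := tailConst_pos h0 h2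
  have h1 := integral_one_sub_cos_mul_abs_rpow h0 h2
  have hi := Integrable.of_integral_ne_zero (h1 ▸ (by positivity :
    2 / (α * tailConst α) ≠ 0) : ∫ x : ℝ, (1 - Real.cos x) * |x| ^ (-1 - α) ≠ 0)
  rcases eq_or_ne u 0 with rfl | hu
  · simp [Real.zero_rpow h0.ne']
  have hu' : 0 < |u| := abs_pos.2 hu
  have e : (fun x : ℝ => (1 - Real.cos (u * x)) * |x| ^ (-1 - α)) =
      fun x => |u| ^ (1 + α) * ((1 - Real.cos (u * x)) * |u * x| ^ (-1 - α)) := by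
    ext x
    rw [abs_mul, Real.mul_rpow hu'.le (abs_nonneg x), show -1 - α = -(1 + α) by ring,
      Real.rpow_neg hu'.le]
    field_simp
  rw [e]
  refine ⟨(hi.comp_mul_left' hu).const_mul _, ?_⟩
  rw [integral_const_mul, Measure.integral_comp_mul_left
    (fun x => (1 - Real.cos x) * |x| ^ (-1 - α)) u, h1, abs_inv, Real.rpow_add hu', Real.rpow_one]
  simp only [smul_eq_mul]
  field_simp

/-! ### The Gaussian kernel and the transform of the weighted Lévy measure. -/

/-- The kernel `1 - exp (-x ^ 2 / 2)`. -/
noncomputable def gaussKernel (x : ℝ) : ℝ := 1 - Real.exp (-x ^ 2 / 2)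

@[fun_prop]
lemma continuous_gaussKernel : Continuous gaussKernel := by
  unfold gaussKernel; fun_prop

lemma gaussKernel_nonneg (x : ℝ) : 0 ≤ gaussKernel x := by
  have : Real.exp (-x ^ 2 / 2) ≤ 1 := Real.exp_le_one_iff.2 (by nlinarith [sq_nonneg x])
  unfold gaussKernel; linarith

lemma gaussKernel_neg (x : ℝ) : gaussKernel (-x) = gaussKernel x := by simp [gaussKernel]

lemma gaussKernel_mono {x y : ℝ} (hx : 0 ≤ x) (h : x ≤ y) : gaussKernel x ≤ gaussKernel y := by
  unfold gaussKernel
  gcongr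

lemma gaussKernel_pos {x : ℝ} (hx : x ≠ 0) : 0 < gaussKernel x := by
  have : Real.exp (-x ^ 2 / 2) < 1 := Real.exp_lt_one_iff.2 (by have := sq_pos_of_ne_zero hx; linarith)
  unfold gaussKernel; linarith

/-- The standard Gaussian measure. -/
noncomputable abbrev stdGauss : Measure ℝ := gaussianReal 0 1

lemma integral_cexp_stdGauss (x : ℝ) :
    ∫ g, Complex.exp (g * x * Complex.I) ∂stdGauss = (Real.exp (-x ^ 2 / 2) : ℝ) := by
  have := charFun_gaussianReal (μ := 0) (v := 1) x
  rw [charFun_apply_real] at this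
  simp_rw [mul_comm (_ : ℂ) (x : ℂ)] at this ⊢
  simp [this, neg_div]

lemma integral_cos_stdGauss (t x : ℝ) :
    ∫ g, Real.cos ((t + g) * x) ∂stdGauss = Real.cos (t * x) * Real.exp (-x ^ 2 / 2) := by
  have hint : Integrable (fun g : ℝ => Complex.exp ((t + g) * x * Complex.I)) stdGauss := by
    refine Integrable.of_bound (Measurable.aestronglyMeasurable (by fun_prop)) 1
      (Eventually.of_forall fun g => ?_)
    have := Complex.norm_exp_ofReal_mul_I ((t + g) * x)
    push_cast at this
    exact this.le
  have h : ∫ g : ℝ, Complex.exp ((t + g) * x * Complex.I) ∂stdGauss =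
      Complex.exp ((t * x : ℝ) * Complex.I) * (Real.exp (-x ^ 2 / 2) : ℝ) := by
    rw [← integral_cexp_stdGauss, ← integral_const_mul]
    congr 1 with g
    rw [← Complex.exp_add]
    push_cast
    ring_nf
  have h2 := congrArg Complex.re h
  rw [Complex.re_mul_ofReal, Complex.exp_ofReal_mul_I_re] at h2
  rw [← h2]
  have := integral_re hint
  simp only [RCLike.re_to_complex] at this
  rw [← this]
  congr 1 with g
  have := Complex.exp_ofReal_mul_I_re ((t + g) * x)
  push_cast at this
  rw [← this]

lemma integral_pos_stdGauss {f : ℝ → ℝ} (hf : Integrable f stdGauss) (h0 : ∀ x, 0 ≤ f x)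
    (hpos : ∀ x, x ≠ 0 → 0 < f x) : 0 < ∫ g, f g ∂stdGauss := by
  rw [integral_pos_iff_support_of_nonneg h0 hf]
  have : ({0}ᶜ : Set ℝ) ⊆ Function.support f := fun x hx => (hpos x hx).ne'
  refine lt_of_lt_of_le ?_ (measure_mono this)
  have := nullSingletonClass_gaussianReal (μ := 0) (v := 1) one_ne_zero
  rw [prob_compl_eq_one_sub (measurableSet_singleton 0)]
  simp

lemma abs_rpow_le {α : ℝ} (h0 : 0 < α) (h2 : α ≤ 2) (x : ℝ) : |x| ^ α ≤ 1 + x ^ 2 := by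
  rcases le_total |x| 1 with h | h
  · have := Real.rpow_le_one (abs_nonneg x) h h0.le
    nlinarith [sq_nonneg x]
  · have := Real.rpow_le_rpow_of_exponent_le h h2
    rw [Real.rpow_two, sq_abs] at this
    linarith

lemma integrable_abs_add_rpow_stdGauss {α : ℝ} (h0 : 0 < α) (h2 : α ≤ 2) (t : ℝ) :
    Integrable (fun g : ℝ => |t + g| ^ α) stdGauss := by
  have h : Integrable (fun g : ℝ => 1 + (t + g) ^ 2) stdGauss := by
    have h1 : MemLp (fun g : ℝ => t + g) 2 stdGauss :=
      (memLp_const t).add (memLp_id_gaussianReal' 2 (by simp))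
    exact (integrable_const 1).add h1.integrable_sq
  refine h.mono' (Measurable.aestronglyMeasurable (by fun_prop)) (Eventually.of_forall fun g => ?_)
  rw [Real.norm_of_nonneg (by positivity)]
  exact abs_rpow_le h0 h2 _

/-- The increment `E |t + G| ^ α - |t| ^ α` for a standard Gaussian `G`. -/
noncomputable def gaussIncr (α t : ℝ) : ℝ := ∫ g, (|t + g| ^ α - |t| ^ α) ∂stdGauss

lemma gaussIncr_zero_pos {α : ℝ} (h0 : 0 < α) (h2 : α ≤ 2) : 0 < gaussIncr α 0 := by
  unfold gaussIncr
  refine integral_pos_stdGauss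
    ((integrable_abs_add_rpow_stdGauss h0 h2 0).sub (integrable_const _)) ?_ ?_
  · intro x
    simp only [sub_zero, abs_zero, Real.zero_rpow h0.ne']
    positivity
  · intro x hx
    have := abs_pos.2 hx
    simp only [sub_zero, abs_zero, Real.zero_rpow h0.ne', zero_add]
    positivity

/-- Averaging over a Gaussian `G` gives `cos (t x) k(x) = E[(1 - cos ((t + G) x)) - (1 - cos (t
x))]`. Each term integrates against `|x| ^ (-1 - α)` to a multiple of `|t + G| ^ α`, respectively
`|t| ^ α`. -/
lemma integrable_kernel_mul_rpow {α : ℝ} (h0 : 0 < α) (h2 : α < 2) (t : ℝ) :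
    Integrable (fun x : ℝ => Real.cos (t * x) * gaussKernel x * |x| ^ (-1 - α)) ∧
    ∫ x : ℝ, Real.cos (t * x) * gaussKernel x * |x| ^ (-1 - α) =
      2 / (α * tailConst α) * gaussIncr α t := by
  have hpos := tailConst_pos h0 h2
  set F : ℝ × ℝ → ℝ := fun p => (1 - Real.cos ((t + p.1) * p.2)) * |p.2| ^ (-1 - α) with hF
  have hw : ∀ x : ℝ, 0 ≤ |x| ^ (-1 - α) := fun x => by positivity
  -- `F` is nonnegative with known integral in `x`, so joint integrability reduces to a Gaussian
  -- moment of order `α`.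
  have hFint : Integrable F (stdGauss.prod volume) := by
    rw [integrable_prod_iff (Measurable.aestronglyMeasurable (by fun_prop))]
    refine ⟨Eventually.of_forall fun g => (integrable_one_sub_cos_mul_abs_rpow h0 h2 (t + g)).1, ?_⟩
    have : (fun g : ℝ => ∫ x, ‖F (g, x)‖) = fun g => |t + g| ^ α * (2 / (α * tailConst α)) := by
      ext g
      rw [← (integrable_one_sub_cos_mul_abs_rpow h0 h2 (t + g)).2]
      congr 1 with x
      exact Real.norm_of_nonneg (mul_nonneg (one_sub_cos_nonneg _) (hw x))
    rw [this]
    exact (integrable_abs_add_rpow_stdGauss h0 h2.le t).mul_const _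
  have hinner : ∀ x, ∫ g, F (g, x) ∂stdGauss =
      (1 - Real.cos (t * x) * Real.exp (-x ^ 2 / 2)) * |x| ^ (-1 - α) := by
    intro x
    simp only [hF]
    rw [integral_mul_const, integral_sub (integrable_const _), integral_cos_stdGauss]
    · simp
    · refine Integrable.of_bound (Measurable.aestronglyMeasurable (by fun_prop)) 1
        (Eventually.of_forall fun g => ?_)
      exact Real.abs_cos_le_one _
  have h3 := integrable_one_sub_cos_mul_abs_rpow h0 h2 t
  have h4 : Integrable (fun x : ℝ =>
      (1 - Real.cos (t * x) * Real.exp (-x ^ 2 / 2)) * |x| ^ (-1 - α)) := by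
    have := hFint.integral_prod_right
    simp_rw [hinner] at this
    exact this
  have e : (fun x : ℝ => Real.cos (t * x) * gaussKernel x * |x| ^ (-1 - α)) = fun x =>
      (1 - Real.cos (t * x) * Real.exp (-x ^ 2 / 2)) * |x| ^ (-1 - α) -
        (1 - Real.cos (t * x)) * |x| ^ (-1 - α) := by
    ext x
    unfold gaussKernel
    ring
  rw [e]
  refine ⟨h4.sub h3.1, ?_⟩
  have h5 : ∫ x : ℝ, (1 - Real.cos (t * x) * Real.exp (-x ^ 2 / 2)) * |x| ^ (-1 - α) =
      (∫ g, |t + g| ^ α ∂stdGauss) * (2 / (α * tailConst α)) := by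
    simp_rw [← hinner]
    rw [← integral_integral_swap hFint, ← integral_mul_const]
    congr 1 with g
    exact (integrable_one_sub_cos_mul_abs_rpow h0 h2 (t + g)).2
  rw [integral_sub h4 h3.1, h3.2, h5, gaussIncr,
    integral_sub (integrable_abs_add_rpow_stdGauss h0 h2.le t) (integrable_const _)]
  simp
  ring

/-- Evenness makes the transforms at `t` and `-t` equal, and their average is the cosine transform.
-/
lemma integral_cexp_mul_of_even {f : ℝ → ℝ} (hf : Integrable f) (heven : ∀ x, f (-x) = f x)
    (t : ℝ) : ∫ x : ℝ, Complex.exp (t * x * Complex.I) * f x =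
      ((∫ x : ℝ, Real.cos (t * x) * f x : ℝ) : ℂ) := by
  have hint : ∀ t : ℝ, Integrable (fun x : ℝ => Complex.exp (t * x * Complex.I) * f x) := by
    intro t
    refine hf.ofReal.bdd_mul (c := 1) (Measurable.aestronglyMeasurable (by fun_prop))
      (Eventually.of_forall fun x => ?_)
    have := Complex.norm_exp_ofReal_mul_I (t * x)
    push_cast at this
    exact this.le
  have h1 : ∫ x : ℝ, Complex.exp (t * x * Complex.I) * f x =
      ∫ x : ℝ, Complex.exp ((-t : ℝ) * x * Complex.I) * f x := by
    rw [← integral_neg_eq_self]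
    congr 1 with x
    rw [heven]
    push_cast
    ring_nf
  have h2 : (2 : ℂ) * ∫ x : ℝ, Complex.exp (t * x * Complex.I) * f x =
      2 * ((∫ x : ℝ, Real.cos (t * x) * f x : ℝ) : ℂ) := by
    rw [two_mul]
    nth_rewrite 2 [h1]
    rw [← integral_add (hint t) (hint (-t)), ← integral_complex_ofReal, ← integral_const_mul]
    congr 1 with x
    push_cast
    rw [Complex.cos]
    ring_nf
  exact mul_left_cancel₀ two_ne_zero h2

/-! ### Weak convergence of the weighted rescaled laws. -/

/-- The probability measure with density proportional to `f` with respect to `μ`. -/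
noncomputable def normDensity (μ : Measure ℝ) (f : ℝ → ℝ) : Measure ℝ :=
  μ.withDensity (fun x => ENNReal.ofReal (f x / ∫ y, f y ∂μ))

lemma isProbabilityMeasure_normDensity {μ : Measure ℝ} {f : ℝ → ℝ} (hf : Integrable f μ)
    (h0 : ∀ x, 0 ≤ f x) (hpos : 0 < ∫ y, f y ∂μ) : IsProbabilityMeasure (normDensity μ f) := by
  constructor
  rw [normDensity, withDensity_apply _ MeasurableSet.univ, Measure.restrict_univ,
    ← ofReal_integral_eq_lintegral_ofReal (hf.div_const _)
      (Eventually.of_forall fun x => div_nonneg (h0 x) hpos.le), integral_div, div_self hpos.ne']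
  simp

lemma integral_normDensity {E : Type*} [NormedAddCommGroup E] [NormedSpace ℝ E]
    {μ : Measure ℝ} {f : ℝ → ℝ} (hm : Measurable f)
    (h0 : ∀ x, 0 ≤ f x) (hpos : 0 < ∫ y, f y ∂μ) (g : ℝ → E) :
    ∫ x, g x ∂(normDensity μ f) = (∫ y, f y ∂μ)⁻¹ • ∫ x, f x • g x ∂μ := by
  rw [normDensity, integral_withDensity_eq_integral_toReal_smul (by fun_prop)
    (Eventually.of_forall fun x => by simp), ← integral_smul]
  congr 1 with x
  rw [ENNReal.toReal_ofReal (div_nonneg (h0 x) hpos.le), smul_smul, div_eq_inv_mul]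

/-- Fubini applied to `k(x) exp (i t x) = E[exp (i t x) - exp (i (t + G) x)]`: the weighted
transform is expressed through `φ` alone. -/
lemma integral_gaussKernel_mul_cexp (ν : Measure ℝ) [IsProbabilityMeasure ν] {φ : ℝ → ℝ}
    (hφ : ∀ t, charFun ν t = (φ t : ℂ)) (t : ℝ) :
    ∫ x, gaussKernel x • Complex.exp (t * x * Complex.I) ∂ν =
      ((∫ g, (φ t - φ (t + g)) ∂stdGauss : ℝ) : ℂ) := by
  have hnorm : ∀ t x : ℝ, ‖Complex.exp (t * x * Complex.I)‖ = 1 := fun t x => by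
    have := Complex.norm_exp_ofReal_mul_I (t * x)
    push_cast at this
    exact this
  have hint : ∀ t : ℝ, Integrable (fun x : ℝ => Complex.exp (t * x * Complex.I)) ν := fun t =>
    Integrable.of_bound (Measurable.aestronglyMeasurable (by fun_prop)) 1
      (Eventually.of_forall fun x => (hnorm t x).le)
  have hprod : Integrable (fun p : ℝ × ℝ => Complex.exp ((t + p.1 : ℝ) * p.2 * Complex.I))
      (stdGauss.prod ν) :=
    Integrable.of_bound (Measurable.aestronglyMeasurable (by fun_prop)) 1
      (Eventually.of_forall fun x => (hnorm _ _).le)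
  have hswap : ∫ g, (φ (t + g) : ℂ) ∂stdGauss =
      ∫ x : ℝ, Complex.exp (t * x * Complex.I) * (Real.exp (-x ^ 2 / 2) : ℝ) ∂ν := by
    simp_rw [← hφ, charFun_apply_real]
    rw [integral_integral_swap hprod]
    congr 1 with x
    rw [← integral_cexp_stdGauss, ← integral_const_mul]
    congr 1 with g
    rw [← Complex.exp_add]
    push_cast
    ring_nf
  have hφint : Integrable (fun g => (φ (t + g) : ℂ)) stdGauss := by
    have := hprod.integral_prod_left
    simpa only [← charFun_apply_real, hφ] using this
  have hexp : Integrable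
      (fun x : ℝ => Complex.exp (t * x * Complex.I) * (Real.exp (-x ^ 2 / 2) : ℝ)) ν := by
    refine Integrable.of_bound (Measurable.aestronglyMeasurable (by fun_prop)) 1
      (Eventually.of_forall fun x => ?_)
    rw [norm_mul, hnorm, one_mul, Complex.norm_real, Real.norm_of_nonneg (Real.exp_pos _).le]
    exact Real.exp_le_one_iff.2 (by nlinarith [sq_nonneg x])
  rw [← integral_complex_ofReal]
  simp only [Complex.ofReal_sub]
  rw [integral_sub (integrable_const _) hφint, hswap]
  simp only [integral_const, probReal_univ, one_smul]
  rw [← hφ, charFun_apply_real, ← integral_sub (hint t) hexp]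
  congr 1 with x
  simp only [gaussKernel, Complex.real_smul]
  push_cast
  ring

/-- This is the derivative of `1 - exp (-c x)` at 0, read along `x = 1 / r`. -/
lemma tendsto_mul_one_sub_exp (c : ℝ) {ι : Type*} {l : Filter ι} {r : ι → ℝ}
    (hr : Tendsto r l atTop) :
    Tendsto (fun i => r i * (1 - Real.exp (-(c * (r i)⁻¹)))) l (𝓝 c) := by
  have h : HasDerivAt (fun x : ℝ => 1 - Real.exp (-(c * x))) c 0 := by
    have h1 : HasDerivAt (fun x : ℝ => Real.exp (-(c * x)))
        (Real.exp (-(c * 0)) * (-(c * 1))) 0 := (((hasDerivAt_id 0).const_mul c).neg).exp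
    simpa using h1.const_sub 1
  have h2 := h.tendsto_slope_zero
  have h3 : Tendsto (fun i => (r i)⁻¹) l (𝓝[≠] 0) :=
    tendsto_nhdsWithin_iff.2 ⟨tendsto_inv_atTop_zero.comp hr, by
      filter_upwards [hr.eventually_gt_atTop 0] with i hi
      exact inv_ne_zero hi.ne'⟩
  refine (h2.comp h3).congr fun i => ?_
  simp

/-- The real characteristic function of the symmetric stable law. -/
noncomputable def stableChar (α σ t : ℝ) : ℝ := Real.exp (-(σ ^ α * |t| ^ α))

@[fun_prop]
lemma measurable_stableChar (α σ : ℝ) : Measurable (stableChar α σ) := by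
  unfold stableChar; fun_prop

lemma stableChar_inv_mul {α σ r : ℝ} (hr : 0 < r) (t : ℝ) :
    stableChar α σ (r⁻¹ * t) = Real.exp (-(σ ^ α * |t| ^ α * (r ^ α)⁻¹)) := by
  rw [stableChar, abs_mul, Real.mul_rpow (abs_nonneg _) (abs_nonneg _),
    abs_of_pos (inv_pos.2 hr), Real.inv_rpow hr.le]
  ring_nf

lemma stableChar_le_one {α σ : ℝ} (hσ : 0 < σ) (t : ℝ) : stableChar α σ t ≤ 1 :=
  Real.exp_le_one_iff.2 (neg_nonpos.2 (by positivity))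

lemma one_sub_stableChar_le {α σ : ℝ} (t : ℝ) : 1 - stableChar α σ t ≤ σ ^ α * |t| ^ α := by
  have := Real.add_one_le_exp (-(σ ^ α * |t| ^ α))
  unfold stableChar
  linarith

lemma integrable_stableChar_sub {α σ : ℝ} (hσ : 0 < σ) (r t : ℝ) :
    Integrable (fun g => stableChar α σ (r * t) - stableChar α σ (r * (t + g))) stdGauss := by
  refine (integrable_const _).sub (Integrable.of_bound
    (Measurable.aestronglyMeasurable (by fun_prop)) 1 (Eventually.of_forall fun x => ?_))
  rw [Real.norm_of_nonneg (show 0 ≤ stableChar α σ _ from (Real.exp_pos _).le)]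
  exact stableChar_le_one hσ _

/-- Dominated convergence: `r ^ α (1 - φ(u / r))` tends to `σ ^ α |u| ^ α` and, as `1 - exp (-v) ≤
v`, never exceeds it. -/
lemma tendsto_integral_stableChar_sub {α σ : ℝ} (h0 : 0 < α) (h2 : α ≤ 2) (hσ : 0 < σ)
    {r : ℕ → ℝ} (hr : Tendsto r atTop atTop) (hr1 : ∀ n, 1 ≤ r n) (t : ℝ) :
    Tendsto (fun n => r n ^ α * ∫ g, (stableChar α σ ((r n)⁻¹ * t) -
      stableChar α σ ((r n)⁻¹ * (t + g))) ∂stdGauss) atTop (𝓝 (σ ^ α * gaussIncr α t)) := by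
  have hr0 : ∀ n, 0 < r n := fun n => one_pos.trans_le (hr1 n)
  simp_rw [gaussIncr, ← integral_const_mul]
  refine tendsto_integral_of_dominated_convergence
    (fun g => σ ^ α * |t| ^ α + σ ^ α * |t + g| ^ α) (fun n => ?_) ?_ (fun n => ?_) ?_
  · exact ((integrable_stableChar_sub hσ _ _).const_mul _).aestronglyMeasurable
  · exact (integrable_const _).add ((integrable_abs_add_rpow_stdGauss h0 h2 t).const_mul _)
  · refine Eventually.of_forall fun g => ?_
    have hb : ∀ u, 0 ≤ 1 - stableChar α σ ((r n)⁻¹ * u) ∧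
        r n ^ α * (1 - stableChar α σ ((r n)⁻¹ * u)) ≤ σ ^ α * |u| ^ α := by
      intro u
      refine ⟨by linarith [stableChar_le_one (α := α) hσ ((r n)⁻¹ * u)], ?_⟩
      have h := one_sub_stableChar_le (α := α) (σ := σ) ((r n)⁻¹ * u)
      rw [abs_mul, Real.mul_rpow (abs_nonneg _) (abs_nonneg _), abs_of_pos (inv_pos.2 (hr0 n)),
        Real.inv_rpow (hr0 n).le] at h
      have hp : 0 < r n ^ α := Real.rpow_pos_of_pos (hr0 n) _
      calc _ ≤ r n ^ α * (σ ^ α * ((r n ^ α)⁻¹ * |u| ^ α)) := by gcongr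
        _ = _ := by field_simp
    have hp : 0 < r n ^ α := Real.rpow_pos_of_pos (hr0 n) _
    have h1 := hb t
    have h3 := hb (t + g)
    have := mul_nonneg hp.le h1.1
    have := mul_nonneg hp.le h3.1
    rw [Real.norm_eq_abs, abs_le]
    constructor <;> nlinarith
  · refine Eventually.of_forall fun g => ?_
    have hra : Tendsto (fun n => r n ^ α) atTop atTop := (tendsto_rpow_atTop h0).comp hr
    have h := (tendsto_mul_one_sub_exp (σ ^ α * |t + g| ^ α) hra).sub
      (tendsto_mul_one_sub_exp (σ ^ α * |t| ^ α) hra)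
    rw [mul_sub]
    refine h.congr fun n => ?_
    rw [stableChar_inv_mul (hr0 n), stableChar_inv_mul (hr0 n)]
    ring

lemma integral_stableChar_sub_pos {α σ : ℝ} (h0 : 0 < α) (hσ : 0 < σ) {r : ℝ} (hr : 0 < r) :
    0 < ∫ g, (stableChar α σ (r * 0) - stableChar α σ (r * (0 + g))) ∂stdGauss := by
  have h1 : stableChar α σ (r * 0) = 1 := by simp [stableChar, Real.zero_rpow h0.ne']
  refine integral_pos_stdGauss (integrable_stableChar_sub hσ r 0) (fun x => ?_) (fun x hx => ?_)
  · rw [h1]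
    linarith [stableChar_le_one (α := α) hσ (r * (0 + x))]
  · rw [h1, sub_pos, zero_add]
    have := abs_pos.2 (mul_ne_zero hr.ne' hx)
    exact Real.exp_lt_one_iff.2 (neg_neg_iff_pos.2 (by positivity))

/-- Lévy's theorem concerns probability measures, so both weighted measures are normalised first;
the total masses are the values of the transforms at 0, and their convergence restores the scale. -/
lemma tendsto_rescaled_integral {μ : Measure ℝ} [IsProbabilityMeasure μ] {α σ : ℝ}
    (h0 : 0 < α) (h2 : α < 2) (hσ : 0 < σ)
    (hμ : ∀ t, charFun μ t = (stableChar α σ t : ℂ))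
    {r : ℕ → ℝ} (hr : Tendsto r atTop atTop) (hr1 : ∀ n, 1 ≤ r n)
    (h : BoundedContinuousFunction ℝ ℝ) :
    Tendsto (fun n => r n ^ α * ∫ x, gaussKernel ((r n)⁻¹ * x) * h ((r n)⁻¹ * x) ∂μ) atTop
      (𝓝 (σ ^ α * (α * tailConst α / 2) *
        ∫ x, gaussKernel x * |x| ^ (-1 - α) * h x)) := by
  have hr0 : ∀ n, 0 < r n := fun n => one_pos.trans_le (hr1 n)
  have hcpos := tailConst_pos h0 h2
  have hIpos := gaussIncr_zero_pos h0 h2.le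
  set ν : ℕ → Measure ℝ := fun n => μ.map (fun x => (r n)⁻¹ * x) with hν
  have hνp : ∀ n, IsProbabilityMeasure (ν n) := fun n =>
    Measure.isProbabilityMeasure_map (by fun_prop)
  have hνc : ∀ n t, charFun (ν n) t = (stableChar α σ ((r n)⁻¹ * t) : ℂ) := fun n t => by
    rw [hν, charFun_map_mul, hμ]
  set N : ℕ → ℝ → ℝ := fun n t => ∫ g, (stableChar α σ ((r n)⁻¹ * t) -
      stableChar α σ ((r n)⁻¹ * (t + g))) ∂stdGauss with hN
  have hNc : ∀ n (t : ℝ), ∫ x, gaussKernel x • Complex.exp (t * x * Complex.I) ∂(ν n) =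
      (N n t : ℂ) := fun n t => integral_gaussKernel_mul_cexp (ν n) (hνc n) t
  have hN0 : ∀ n, ∫ x, gaussKernel x ∂(ν n) = N n 0 := by
    intro n
    have := hNc n 0
    simp only [Complex.ofReal_zero, zero_mul, Complex.exp_zero, Complex.real_smul, mul_one] at this
    rw [integral_complex_ofReal] at this
    exact_mod_cast this
  have hNpos : ∀ n, 0 < ∫ x, gaussKernel x ∂(ν n) := fun n => by
    rw [hN0]
    exact integral_stableChar_sub_pos h0 hσ (inv_pos.2 (hr0 n))
  have hkint : ∀ n, Integrable gaussKernel (ν n) := fun n =>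
    Integrable.of_integral_ne_zero (hNpos n).ne'
  set q : ℕ → ProbabilityMeasure ℝ := fun n => ⟨normDensity (ν n) gaussKernel,
    isProbabilityMeasure_normDensity (hkint n) gaussKernel_nonneg (hNpos n)⟩ with hq
  set f : ℝ → ℝ := fun x => gaussKernel x * |x| ^ (-1 - α) with hf
  have hf0 : ∀ x, 0 ≤ f x := fun x => mul_nonneg (gaussKernel_nonneg x) (by positivity)
  have hfm : Measurable f := continuous_gaussKernel.measurable.mul (by fun_prop)
  have hfI : ∫ x, f x = 2 / (α * tailConst α) * gaussIncr α 0 := by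
    simpa using (integrable_kernel_mul_rpow h0 h2 0).2
  have hfint : Integrable f := by simpa using (integrable_kernel_mul_rpow h0 h2 0).1
  have hfpos : 0 < ∫ x, f x := by rw [hfI]; positivity
  set q0 : ProbabilityMeasure ℝ := ⟨normDensity volume f,
    isProbabilityMeasure_normDensity hfint hf0 hfpos⟩ with hq0
  have hlimN : ∀ t, Tendsto (fun n => r n ^ α * N n t) atTop (𝓝 (σ ^ α * gaussIncr α t)) :=
    tendsto_integral_stableChar_sub h0 h2.le hσ hr hr1
  have hσα : 0 < σ ^ α := Real.rpow_pos_of_pos hσ _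
  have hconv : Tendsto q atTop (𝓝 q0) := by
    refine ProbabilityMeasure.tendsto_of_tendsto_charFun fun t => ?_
    -- The factor `r n ^ α` cancels in the quotient; it is inserted so that numerator and
    -- denominator both converge.
    have e1 : ∀ n, charFun (q n : Measure ℝ) t = ((r n ^ α * N n t) / (r n ^ α * N n 0) : ℝ) := by
      intro n
      have hp : 0 < r n ^ α := Real.rpow_pos_of_pos (hr0 n) _
      rw [charFun_apply_real]
      change ∫ x, _ ∂(normDensity (ν n) gaussKernel) = _
      rw [integral_normDensity continuous_gaussKernel.measurable gaussKernel_nonneg (hNpos n),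
        hNc, hN0, mul_div_mul_left _ _ hp.ne', Complex.real_smul, div_eq_inv_mul]
      push_cast
      rfl
    have e2 : charFun (q0 : Measure ℝ) t =
        ((σ ^ α * gaussIncr α t) / (σ ^ α * gaussIncr α 0) : ℝ) := by
      rw [charFun_apply_real]
      change ∫ x, _ ∂(normDensity volume f) = _
      rw [integral_normDensity hfm hf0 hfpos]
      have e3 : ∀ x : ℝ, f x • Complex.exp (t * x * Complex.I) =
          Complex.exp (t * x * Complex.I) * (f x : ℂ) := fun x => by
        rw [Complex.real_smul, mul_comm]
      simp_rw [e3]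
      rw [integral_cexp_mul_of_even hfint (fun x => by
        simp only [hf, gaussKernel_neg, abs_neg])]
      simp only [hf, ← mul_assoc]
      rw [(integrable_kernel_mul_rpow h0 h2 t).2, Complex.real_smul, ← Complex.ofReal_mul]
      congr 1
      change (∫ x, f x)⁻¹ * _ = _
      rw [hfI]
      field_simp
    rw [e2]
    simp_rw [e1]
    exact (Complex.continuous_ofReal.tendsto _).comp
      ((hlimN t).div (hlimN 0) (by positivity))
  have hh := ProbabilityMeasure.tendsto_iff_forall_integral_tendsto.1 hconv h
  have hh2 := (hlimN 0).mul hh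
  have e0 : σ ^ α * gaussIncr α 0 * ∫ x, h x ∂(q0 : Measure ℝ) =
      σ ^ α * (α * tailConst α / 2) * ∫ x, gaussKernel x * |x| ^ (-1 - α) * h x := by
    change _ * ∫ x, _ ∂(normDensity volume f) = _
    rw [integral_normDensity hfm hf0 hfpos, hfI]
    simp only [smul_eq_mul, hf]
    field_simp
  rw [e0] at hh2
  refine hh2.congr fun n => ?_
  change _ * ∫ x, _ ∂(normDensity (ν n) gaussKernel) = _
  rw [integral_normDensity continuous_gaussKernel.measurable gaussKernel_nonneg (hNpos n),
    ← hN0, smul_eq_mul, mul_assoc, mul_inv_cancel_left₀ (hNpos n).ne', hν,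
    integral_map (by fun_prop)]
  · rfl
  · exact Measurable.aestronglyMeasurable (continuous_gaussKernel.measurable.mul (by fun_prop))

/-! ### From weak convergence to the stable tail. -/

/-- The piecewise linear function that vanishes on `(-∞, a]` and equals `1` on `[b, ∞)`. -/
noncomputable def ramp (a b x : ℝ) : ℝ := min 1 (max 0 ((x - a) / (b - a)))

@[fun_prop]
lemma continuous_ramp (a b : ℝ) : Continuous (ramp a b) := by
  unfold ramp; fun_prop

lemma ramp_nonneg (a b x : ℝ) : 0 ≤ ramp a b x := le_min zero_le_one (le_max_left _ _)

lemma ramp_le_one (a b x : ℝ) : ramp a b x ≤ 1 := min_le_left _ _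

lemma ramp_of_le {a b x : ℝ} (hab : a < b) (hx : x ≤ a) : ramp a b x = 0 := by
  have : (x - a) / (b - a) ≤ 0 := div_nonpos_of_nonpos_of_nonneg (by linarith) (by linarith)
  simp [ramp, max_eq_left this]

lemma ramp_of_ge {a b x : ℝ} (hab : a < b) (hx : b ≤ x) : ramp a b x = 1 := by
  have : 1 ≤ (x - a) / (b - a) := by rw [one_le_div (by linarith)]; linarith
  exact min_eq_left (this.trans (le_max_right _ _))

lemma ramp_le_indicator {a b : ℝ} (hab : a < b) (x : ℝ) :
    ramp a b x ≤ (Ioi a).indicator 1 x := by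
  by_cases hx : x ∈ Ioi a
  · simpa [hx] using ramp_le_one a b x
  · simp [hx, ramp_of_le hab (not_lt.1 hx)]

lemma indicator_le_ramp {a b : ℝ} (hab : a < b) (x : ℝ) :
    (Ioi b).indicator 1 x ≤ ramp a b x := by
  by_cases hx : x ∈ Ioi b
  · simp [hx, ramp_of_ge hab (le_of_lt hx)]
  · simpa [hx] using ramp_nonneg a b x

/-- The quotient of a ramp function by the Gaussian kernel, as a bounded continuous function. -/
noncomputable def rampDiv (a b : ℝ) (ha : 0 < a) : BoundedContinuousFunction ℝ ℝ :=
  BoundedContinuousFunction.ofNormedAddCommGroup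
    (fun x => ramp a b x / max (gaussKernel x) (gaussKernel a))
    ((continuous_ramp a b).div (by fun_prop) fun x =>
      (lt_max_of_lt_right (gaussKernel_pos ha.ne')).ne')
    (1 / gaussKernel a) fun x => by
      have hk := gaussKernel_pos ha.ne'
      rw [Real.norm_of_nonneg (div_nonneg (ramp_nonneg _ _ _) (hk.le.trans (le_max_right _ _)))]
      exact div_le_div₀ zero_le_one (ramp_le_one _ _ _) hk (le_max_right _ _)

/-- The `max` in `rampDiv` keeps the denominator away from 0 and does no harm: for `x ≤ a` the ramp
vanishes, and for `x > a` the maximum is the kernel itself. -/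
lemma gaussKernel_mul_rampDiv {a b : ℝ} (ha : 0 < a) (hab : a < b) (x : ℝ) :
    gaussKernel x * rampDiv a b ha x = ramp a b x := by
  change gaussKernel x * (ramp a b x / max (gaussKernel x) (gaussKernel a)) = _
  rcases le_or_gt x a with hx | hx
  · simp [ramp_of_le hab hx]
  · rw [max_eq_left (gaussKernel_mono ha.le hx.le)]
    have := gaussKernel_pos (ha.trans hx).ne'
    field_simp

lemma tendsto_rescaled_ramp {μ : Measure ℝ} [IsProbabilityMeasure μ] {α σ : ℝ}
    (h0 : 0 < α) (h2 : α < 2) (hσ : 0 < σ)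
    (hμ : ∀ t, charFun μ t = (stableChar α σ t : ℂ)) {a b : ℝ} (ha : 0 < a) (hab : a < b) :
    Tendsto (fun r : ℝ => r ^ α * ∫ x, ramp a b (r⁻¹ * x) ∂μ) atTop
      (𝓝 (σ ^ α * (α * tailConst α / 2) * ∫ x, ramp a b x * |x| ^ (-1 - α))) := by
  refine tendsto_of_seq_tendsto fun u hu => ?_
  -- Truncating the scales at 1 changes only finitely many of them.
  have h := tendsto_rescaled_integral h0 h2 hσ hμ (r := fun n => max (u n) 1)
    (tendsto_atTop_mono (fun n => le_max_left _ _) hu) (fun n => le_max_right _ _)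
    (rampDiv a b ha)
  have e : ∀ x : ℝ, gaussKernel x * |x| ^ (-1 - α) * rampDiv a b ha x =
      ramp a b x * |x| ^ (-1 - α) := fun x => by
    rw [mul_right_comm, gaussKernel_mul_rampDiv ha hab]
  simp only [e, gaussKernel_mul_rampDiv ha hab] at h
  refine h.congr' ?_
  filter_upwards [hu.eventually_ge_atTop 1] with n hn
  simp only [Function.comp, max_eq_left hn]

lemma integral_ramp_bounds {α : ℝ} (h0 : 0 < α) {a b : ℝ} (ha : 0 < a) (hab : a < b) :
    b ^ (-α) / α ≤ ∫ x, ramp a b x * |x| ^ (-1 - α) ∧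
      ∫ x, ramp a b x * |x| ^ (-1 - α) ≤ a ^ (-α) / α := by
  have hI : ∀ c : ℝ, 0 < c → Integrable ((Ioi c).indicator fun x : ℝ => |x| ^ (-1 - α)) ∧
      ∫ x, (Ioi c).indicator (fun x : ℝ => |x| ^ (-1 - α)) x = c ^ (-α) / α := by
    intro c hc
    have e : ∀ x ∈ Ioi c, |x| ^ (-1 - α) = x ^ (-1 - α) := fun x hx => by
      rw [abs_of_pos (hc.trans hx)]
    constructor
    · rw [integrable_indicator_iff measurableSet_Ioi, integrableOn_congr_fun e measurableSet_Ioi]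
      exact integrableOn_Ioi_rpow_of_lt (by linarith) hc
    · rw [integral_indicator measurableSet_Ioi, setIntegral_congr_fun measurableSet_Ioi e,
        integral_Ioi_rpow_of_lt (by linarith) hc]
      rw [show -1 - α + 1 = -α by ring]
      field_simp
  have hw : ∀ x : ℝ, 0 ≤ |x| ^ (-1 - α) := fun x => by positivity
  have hind : ∀ c x : ℝ, (Ioi c).indicator (fun x : ℝ => |x| ^ (-1 - α)) x =
      (Ioi c).indicator 1 x * |x| ^ (-1 - α) := fun c x => by
    by_cases hx : x ∈ Ioi c <;> simp [hx]
  have hle : ∀ x, ramp a b x * |x| ^ (-1 - α) ≤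
      (Ioi a).indicator (fun x : ℝ => |x| ^ (-1 - α)) x := fun x => by
    rw [hind]
    exact mul_le_mul_of_nonneg_right (ramp_le_indicator hab x) (hw x)
  have hint : Integrable fun x => ramp a b x * |x| ^ (-1 - α) := by
    refine (hI a ha).1.mono' (Measurable.aestronglyMeasurable
      ((continuous_ramp a b).measurable.mul (by fun_prop))) (Eventually.of_forall fun x => ?_)
    rw [Real.norm_of_nonneg (mul_nonneg (ramp_nonneg _ _ _) (hw x))]
    exact hle x
  rw [← (hI a ha).2, ← (hI b (ha.trans hab)).2]
  refine ⟨integral_mono (hI b (ha.trans hab)).1 hint fun x => ?_,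
    integral_mono hint (hI a ha).1 hle⟩
  simp only [hind]
  exact mul_le_mul_of_nonneg_right (indicator_le_ramp hab x) (hw x)

lemma integral_rescaled_ramp_bounds (μ : Measure ℝ) [IsProbabilityMeasure μ] {a b r : ℝ}
    (hab : a < b) (hr : 0 < r) :
    μ.real (Ioi (r * b)) ≤ ∫ x, ramp a b (r⁻¹ * x) ∂μ ∧
      ∫ x, ramp a b (r⁻¹ * x) ∂μ ≤ μ.real (Ioi (r * a)) := by
  have hint : Integrable (fun x => ramp a b (r⁻¹ * x)) μ := by
    refine Integrable.of_bound (Continuous.aestronglyMeasurable (by fun_prop)) 1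
      (Eventually.of_forall fun x => ?_)
    rw [Real.norm_of_nonneg (ramp_nonneg _ _ _)]
    exact ramp_le_one _ _ _
  have hind : ∀ c : ℝ, Integrable ((Ioi c).indicator (1 : ℝ → ℝ)) μ := fun c =>
    (integrable_const (1 : ℝ)).indicator measurableSet_Ioi
  have e : ∀ c x : ℝ, (Ioi c).indicator (1 : ℝ → ℝ) (r⁻¹ * x) = (Ioi (r * c)).indicator 1 x := by
    intro c x
    have : r⁻¹ * x ∈ Ioi c ↔ x ∈ Ioi (r * c) := by
      simp only [mem_Ioi]
      rw [lt_inv_mul_iff₀ hr]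
    by_cases hx : x ∈ Ioi (r * c)
    · simp [hx, this.2 hx]
    · simp [hx, mt this.1 hx]
  rw [← integral_indicator_one measurableSet_Ioi, ← integral_indicator_one measurableSet_Ioi]
  constructor
  · refine integral_mono (hind _) hint fun x => ?_
    simp only
    rw [← e]
    exact indicator_le_ramp hab _
  · refine integral_mono hint (hind _) fun x => ?_
    simp only
    rw [← e]
    exact ramp_le_indicator hab _

/-- The tail of a symmetric stable law of index `α < 2`. -/
theorem tendsto_rpow_mul_tail {μ : Measure ℝ} [IsProbabilityMeasure μ] {α σ : ℝ}
    (h0 : 0 < α) (h2 : α < 2) (hσ : 0 < σ)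
    (hμ : ∀ t, charFun μ t = (stableChar α σ t : ℂ)) :
    Tendsto (fun r : ℝ => r ^ α * μ.real (Ioi r)) atTop (𝓝 (tailConst α * σ ^ α / 2)) := by
  set D := tailConst α * σ ^ α / 2 with hD
  have hcpos := tailConst_pos h0 h2
  have hσα : 0 < σ ^ α := Real.rpow_pos_of_pos hσ _
  have hlim : Tendsto (fun b : ℝ => D * b ^ (-α)) (𝓝 1) (𝓝 D) := by
    have : ContinuousAt (fun b : ℝ => D * b ^ (-α)) 1 :=
      (Real.continuousAt_rpow_const 1 (-α) (Or.inl one_ne_zero)).const_mul D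
    simpa using this.tendsto
  have hDc : ∀ v : ℝ, σ ^ α * (α * tailConst α / 2) * (v / α) = D * v := fun v => by
    rw [hD]; field_simp
  have hKpos : 0 < σ ^ α * (α * tailConst α / 2) := by positivity
  -- The indicator of `(1, ∞)` lies above the ramp from 1 to `b > 1` and below the ramp from `a < 1`
  -- to 1. The limits for these ramps are at least `D * b ^ (-α)` and at most `D * a ^ (-α)`, both
  -- close to `D`.
  refine tendsto_order.2 ⟨fun y hy => ?_, fun y hy => ?_⟩
  · obtain ⟨b, hyb, hb⟩ := (((hlim.mono_left nhdsWithin_le_nhds).eventually_const_lt hy).and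
      (self_mem_nhdsWithin : Ioi (1 : ℝ) ∈ 𝓝[>] 1)).exists
    have hb' := (integral_ramp_bounds h0 one_pos hb).1
    have hT := tendsto_rescaled_ramp h0 h2 hσ hμ one_pos hb
    have hlt := hT.eventually_const_lt (u := y) (hyb.trans_le (by rw [← hDc]; gcongr))
    filter_upwards [hlt, eventually_gt_atTop 0] with r hr hr0
    refine hr.trans_le ?_
    have := (integral_rescaled_ramp_bounds μ hb hr0).2
    rw [mul_one] at this
    gcongr
  · obtain ⟨a, ⟨hya, ha0⟩, ha⟩ := ((((hlim.mono_left nhdsWithin_le_nhds).eventually_lt_const hy).and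
      (nhdsWithin_le_nhds (Ioi_mem_nhds zero_lt_one))).and
      (self_mem_nhdsWithin : Iio (1 : ℝ) ∈ 𝓝[<] 1)).exists
    have ha' := (integral_ramp_bounds h0 ha0 ha).2
    have hT := tendsto_rescaled_ramp h0 h2 hσ hμ ha0 ha
    have hlt := hT.eventually_lt_const (u := y) (lt_of_le_of_lt (by rw [← hDc]; gcongr) hya)
    filter_upwards [hlt, eventually_gt_atTop 0] with r hr hr0
    refine lt_of_le_of_lt ?_ hr
    have := (integral_rescaled_ramp_bounds μ ha hr0).1
    rw [mul_one] at this
    gcongr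

/-! ### Products of independent variables with power tails. -/

section Product

variable {Ω : Type*} [MeasurableSpace Ω] {P : Measure Ω} [IsProbabilityMeasure P]

lemma survival_nonneg (P : Measure Ω) (W : Ω → ℝ) (s : ℝ) : 0 ≤ survival P W s :=
  measureReal_nonneg

lemma survival_le_one (P : Measure Ω) [IsProbabilityMeasure P] (W : Ω → ℝ) (s : ℝ) :
    survival P W s ≤ 1 := measureReal_le_one

lemma antitone_survival (P : Measure Ω) [IsProbabilityMeasure P] (W : Ω → ℝ) :
    Antitone (survival P W) := fun _ _ h => measureReal_mono fun _ hω => lt_of_le_of_lt h hω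

@[fun_prop]
lemma measurable_survival (P : Measure Ω) [IsProbabilityMeasure P] (W : Ω → ℝ) :
    Measurable (survival P W) := (antitone_survival P W).measurable

lemma rpow_mul_survival_bdd {W : Ω → ℝ} {a A : ℝ} (ha : 0 < a)
    (h : Tendsto (fun s => s ^ a * survival P W s) atTop (𝓝 A)) :
    ∃ C, 0 ≤ C ∧ ∀ s, 0 ≤ s → s ^ a * survival P W s ≤ C := by
  obtain ⟨S, hS⟩ := eventually_atTop.1 (h.eventually_le_const (lt_add_one A))
  refine ⟨max (A + 1) (max S 0 ^ a), le_max_of_le_right (by positivity), fun s hs => ?_⟩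
  rcases le_total S s with h1 | h1
  · exact (hS s h1).trans (le_max_left _ _)
  · refine le_max_of_le_right ?_
    calc s ^ a * survival P W s ≤ s ^ a * 1 := by
          gcongr
          exact survival_le_one P W s
      _ ≤ max S 0 ^ a := by
          rw [mul_one]
          gcongr
          exact h1.trans (le_max_left _ _)

/-- Condition on `V` and use `z ^ a = V ^ a (z / V) ^ a`. -/
lemma rpow_mul_survival_mul {W V : Ω → ℝ} (hW : Measurable W) (hV : Measurable V)
    (hV0 : ∀ ω, 0 ≤ V ω) (hind : IndepFun W V P) {a : ℝ} (ha : 0 < a) {z : ℝ} (hz : 0 < z) :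
    z ^ a * survival P (fun ω => W ω * V ω) z =
      ∫ ω, V ω ^ a * ((z / V ω) ^ a * survival P W (z / V ω)) ∂P := by
  have hset : MeasurableSet {p : ℝ × ℝ | z < p.1 * p.2} :=
    measurableSet_lt measurable_const (by fun_prop)
  have : IsProbabilityMeasure (P.map W) := Measure.isProbabilityMeasure_map hW.aemeasurable
  have : IsProbabilityMeasure (P.map V) := Measure.isProbabilityMeasure_map hV.aemeasurable
  have h1 : survival P (fun ω => W ω * V ω) z =
      ∫ v, (P.map W).real {w | z < w * v} ∂(P.map V) := by
    have e : survival P (fun ω => W ω * V ω) z =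
        (P.map (fun ω => (W ω, V ω))).real {p : ℝ × ℝ | z < p.1 * p.2} := by
      rw [map_measureReal_apply (by fun_prop) hset]
      rfl
    have hi : Integrable ({p : ℝ × ℝ | z < p.1 * p.2}.indicator (1 : ℝ × ℝ → ℝ))
        ((P.map W).prod (P.map V)) := (integrable_const (1 : ℝ)).indicator hset
    rw [e, (indepFun_iff_map_prod_eq_prod_map_map hW.aemeasurable hV.aemeasurable).1 hind,
      ← integral_indicator_one hset, integral_prod_symm _ hi]
    congr 1 with v
    rw [← integral_indicator_one (measurableSet_lt measurable_const (by fun_prop))]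
    rfl
  have h2 : ∀ v : ℝ, 0 ≤ v → z ^ a * (P.map W).real {w | z < w * v} =
      v ^ a * ((z / v) ^ a * survival P W (z / v)) := by
    intro v hv
    -- At `v = 0` the event is empty since `z > 0`, and the right side vanishes through `0 ^ a = 0`,
    -- whatever the value of `z / 0`.
    rcases hv.eq_or_lt with rfl | hv
    · have : {w : ℝ | z < w * 0} = ∅ := by
        ext w; simp [hz.le]
      rw [this, measureReal_empty]
      simp [Real.zero_rpow ha.ne']
    · rw [map_measureReal_apply hW (measurableSet_lt measurable_const (by fun_prop)),
        ← mul_assoc, ← Real.mul_rpow hv.le (by positivity), mul_div_cancel₀ _ hv.ne']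
      congr 2
      ext ω
      simp [div_lt_iff₀ hv]
  have hm : Measurable fun v : ℝ => (P.map W).real {w | z < w * v} := by
    have := measurable_measure_prodMk_right (μ := P.map W) hset
    exact this.ennreal_toReal
  rw [h1, ← integral_const_mul, integral_map hV.aemeasurable (hm.const_mul _).aestronglyMeasurable]
  exact integral_congr_ae (Eventually.of_forall fun ω => h2 _ (hV0 ω))

/-- Breiman's lemma: if `W` has a power tail of index `a` and `V ≥ 0` is independent of `W` with
`E V ^ a < ∞`, then `W * V` has a power tail of index `a`. -/
theorem tendsto_survival_mul_of_integrable {W V : Ω → ℝ} (hW : Measurable W) (hV : Measurable V)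
    (hV0 : ∀ ω, 0 ≤ V ω) (hind : IndepFun W V P) {a A : ℝ} (ha : 0 < a)
    (hA : Tendsto (fun s => s ^ a * survival P W s) atTop (𝓝 A))
    (hint : Integrable (fun ω => V ω ^ a) P) :
    Tendsto (fun z => z ^ a * survival P (fun ω => W ω * V ω) z) atTop
      (𝓝 (A * ∫ ω, V ω ^ a ∂P)) := by
  obtain ⟨C, hC0, hC⟩ := rpow_mul_survival_bdd ha hA
  have key : Tendsto (fun z => ∫ ω, V ω ^ a * ((z / V ω) ^ a * survival P W (z / V ω)) ∂P) atTop
      (𝓝 (∫ ω, V ω ^ a * A ∂P)) := by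
    -- `C` bounds `s ^ a P(W > s)` over all `s ≥ 0`, so it serves every `z` and every value of `V`.
    refine tendsto_integral_filter_of_dominated_convergence (fun ω => V ω ^ a * C)
      (Eventually.of_forall fun z => Measurable.aestronglyMeasurable (by fun_prop)) ?_
      (hint.mul_const _) (Eventually.of_forall fun ω => ?_)
    · filter_upwards [eventually_ge_atTop 0] with z hz
      refine Eventually.of_forall fun ω => ?_
      have h1 : 0 ≤ z / V ω := div_nonneg hz (hV0 ω)
      have h2 := Real.rpow_nonneg (hV0 ω) a
      rw [Real.norm_of_nonneg (mul_nonneg h2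
        (mul_nonneg (Real.rpow_nonneg h1 a) (survival_nonneg _ _ _)))]
      exact mul_le_mul_of_nonneg_left (hC _ h1) h2
    · rcases (hV0 ω).eq_or_lt with h | h
      · simp [← h, Real.zero_rpow ha.ne']
      · exact (hA.comp (tendsto_id.atTop_div_const h)).const_mul _
  rw [integral_mul_const, mul_comm] at key
  refine key.congr' ?_
  filter_upwards [eventually_gt_atTop 0] with z hz
  exact (rpow_mul_survival_mul hW hV hV0 hind ha hz).symm

/-- Layer-cake formula: truncating `V` at `z` cuts the integral of its survival function at `z`. -/
lemma integral_min_rpow {V : Ω → ℝ} (hV : Measurable V) (hV0 : ∀ ω, 0 ≤ V ω) {a : ℝ} (ha : 0 < a)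
    {z : ℝ} (hz : 0 ≤ z) :
    ∫ ω, (min (V ω) z) ^ a ∂P = a * ∫ t in (0 : ℝ)..z, survival P V t * t ^ (a - 1) := by
  have hm0 : ∀ ω, 0 ≤ min (V ω) z := fun ω => le_min (hV0 ω) hz
  have hlayer := lintegral_rpow_eq_lintegral_meas_lt_mul P (f := fun ω => min (V ω) z)
    (Eventually.of_forall hm0) (by fun_prop) ha
  have e1 : ∀ t ∈ Ioi (0 : ℝ), P {ω | t < min (V ω) z} * ENNReal.ofReal (t ^ (a - 1)) =
      ENNReal.ofReal ((Iio z).indicator (fun t => survival P V t * t ^ (a - 1)) t) := by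
    intro t (ht : 0 < t)
    by_cases htz : t < z
    · have : {ω | t < min (V ω) z} = {ω | t < V ω} := by ext ω; simp [htz]
      rw [this, indicator_of_mem (mem_Iio.2 htz), ENNReal.ofReal_mul (survival_nonneg _ _ _),
        survival, ofReal_measureReal]
    · have : {ω | t < min (V ω) z} = ∅ := by ext ω; simp [htz]
      rw [this]
      simp [htz]
  rw [integral_eq_lintegral_of_nonneg_ae (Eventually.of_forall fun ω => Real.rpow_nonneg (hm0 ω) a)
    (Measurable.aestronglyMeasurable (by fun_prop)), hlayer, ENNReal.toReal_mul,
    ENNReal.toReal_ofReal ha.le, setLIntegral_congr_fun measurableSet_Ioi e1,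
    ← integral_eq_lintegral_of_nonneg_ae, intervalIntegral.integral_of_le hz,
    integral_Ioc_eq_integral_Ioo, setIntegral_indicator measurableSet_Iio, Ioi_inter_Iio]
  · filter_upwards [ae_restrict_mem measurableSet_Ioi] with t (ht : 0 < t)
    exact indicator_apply_nonneg fun _ => mul_nonneg (survival_nonneg _ _ _) (by positivity)
  · exact Measurable.aestronglyMeasurable (Measurable.indicator (by fun_prop) measurableSet_Iio)

/-- A Cesàro argument: the weight `1 / t` has mass `log z` on `[1, z]`, and any bounded initial
stretch is negligible against it. -/
lemma tendsto_integral_div_log {h : ℝ → ℝ} {B : ℝ} (hm : Measurable h) {C : ℝ}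
    (hC : ∀ t, 1 ≤ t → |h t| ≤ C) (hB : Tendsto h atTop (𝓝 B)) :
    Tendsto (fun z => (∫ t in (1 : ℝ)..z, h t / t) / Real.log z) atTop (𝓝 B) := by
  have hint : ∀ u v : ℝ, 1 ≤ u → 1 ≤ v →
      IntervalIntegrable (fun t => (h t - B) / t) volume u v := by
    intro u v hu hv
    refine (intervalIntegrable_const (c := C + |B|)).mono_fun'
      (Measurable.aestronglyMeasurable (by fun_prop)) ?_
    filter_upwards [ae_restrict_mem measurableSet_uIoc] with t ht
    have ht1 : 1 ≤ t := (le_min hu hv).trans ht.1.le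
    rw [norm_div, Real.norm_of_nonneg (zero_le_one.trans ht1)]
    refine (div_le_self (norm_nonneg _) ht1).trans ((abs_sub _ _).trans ?_)
    linarith [hC t ht1]
  have hinv : ∀ z : ℝ, 1 ≤ z → IntervalIntegrable (fun t : ℝ => B / t) volume 1 z := by
    intro z hz
    refine ContinuousOn.intervalIntegrable fun t ht => ContinuousAt.continuousWithinAt ?_
    rw [uIcc_of_le hz] at ht
    exact continuousAt_const.div continuousAt_id (by have := ht.1; simp; linarith)
  have hdiff : ∀ z : ℝ, 1 ≤ z → ∫ t in (1 : ℝ)..z, h t / t =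
      (∫ t in (1 : ℝ)..z, (h t - B) / t) + B * Real.log z := by
    intro z hz
    have : ∫ t in (1 : ℝ)..z, B / t = B * Real.log z := by
      simp_rw [div_eq_mul_inv]
      rw [intervalIntegral.integral_const_mul, integral_inv_of_pos one_pos (by linarith), div_one]
    rw [← this, ← intervalIntegral.integral_add (hint 1 z le_rfl hz) (hinv z hz)]
    congr 1 with t
    ring
  suffices hs : Tendsto (fun z => (∫ t in (1 : ℝ)..z, (h t - B) / t) / Real.log z) atTop (𝓝 0) by
    have := hs.add_const B
    rw [zero_add] at this
    refine this.congr' ?_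
    filter_upwards [eventually_gt_atTop 1] with z hz
    have := Real.log_pos hz
    rw [hdiff z hz.le]
    field_simp
  rw [Metric.tendsto_atTop']
  intro ε hε
  obtain ⟨S, hS⟩ := (Metric.tendsto_atTop.1 hB) (ε / 2) (by positivity)
  set T := max S 1 with hT
  have hT1 : 1 ≤ T := le_max_right _ _
  set K := |∫ t in (1 : ℝ)..T, (h t - B) / t| with hK
  obtain ⟨Z, hZ⟩ := eventually_atTop.1 (Real.tendsto_log_atTop.eventually_gt_atTop (K / (ε / 2)))
  refine ⟨max (max Z T) 1, fun z hz => ?_⟩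
  have hz1 : 1 < z := (le_max_right _ _).trans_lt hz
  have hzT : T ≤ z := ((le_max_right Z T).trans (le_max_left _ _)).trans hz.le
  have hzZ : Z ≤ z := ((le_max_left Z T).trans (le_max_left _ _)).trans hz.le
  have hlog := Real.log_pos hz1
  have hKlog := hZ z hzZ
  rw [div_lt_iff₀ (by positivity)] at hKlog
  have h2 : |∫ t in T..z, (h t - B) / t| ≤ ε / 2 * Real.log z := by
    have hb : ‖∫ t in T..z, (h t - B) / t‖ ≤ ∫ t in T..z, (ε / 2) * t⁻¹ := by
      refine intervalIntegral.norm_integral_le_of_norm_le hzT (Eventually.of_forall fun t ht => ?_)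
        ?_
      · have ht0 : 0 < t := one_pos.trans_le (hT1.trans ht.1.le)
        have := hS t ((le_max_left _ _).trans ht.1.le)
        rw [Real.dist_eq] at this
        rw [norm_div, Real.norm_of_nonneg ht0.le, Real.norm_eq_abs, div_eq_mul_inv]
        gcongr
      · refine ContinuousOn.intervalIntegrable fun t ht => ContinuousAt.continuousWithinAt ?_
        rw [uIcc_of_le hzT] at ht
        exact continuousAt_const.mul (continuousAt_inv₀ (by have := ht.1; linarith))
    rw [intervalIntegral.integral_const_mul, integral_inv_of_pos (by linarith) (by linarith)] at hb
    refine hb.trans ?_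
    gcongr
    exact div_le_self (by linarith) hT1
  rw [Real.dist_eq, sub_zero, abs_div, abs_of_pos hlog, div_lt_iff₀ hlog,
    ← intervalIntegral.integral_add_adjacent_intervals (hint 1 T le_rfl hT1)
      (hint T z hT1 hz1.le)]
  refine (abs_add_le _ _).trans_lt ?_
  calc _ < Real.log z * (ε / 2) + ε / 2 * Real.log z := add_lt_add_of_lt_of_le hKlog h2
    _ = ε * Real.log z := by ring

/-- In the layer-cake integral the integrand is asymptotically `B / t`, while the part over `[0, 1]`
is a constant. -/
lemma tendsto_integral_min_rpow_div_log {V : Ω → ℝ} (hV : Measurable V) (hV0 : ∀ ω, 0 ≤ V ω)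
    {a B : ℝ} (ha : 0 < a) (hB : Tendsto (fun s => s ^ a * survival P V s) atTop (𝓝 B)) :
    Tendsto (fun z => (∫ ω, (min (V ω) z) ^ a ∂P) / Real.log z) atTop (𝓝 (a * B)) := by
  obtain ⟨C, hC0, hC⟩ := rpow_mul_survival_bdd ha hB
  have h1 := tendsto_integral_div_log (h := fun s => s ^ a * survival P V s) (by fun_prop)
    (C := C) (fun t ht => by
      have ht0 : 0 ≤ t := zero_le_one.trans ht
      rw [abs_of_nonneg (mul_nonneg (by positivity) (survival_nonneg _ _ _))]
      exact hC t ht0) hB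
  have h2 : Tendsto (fun z => (∫ t in (0 : ℝ)..1, survival P V t * t ^ (a - 1)) / Real.log z)
      atTop (𝓝 0) := tendsto_const_nhds.div_atTop Real.tendsto_log_atTop
  have h3 := (h2.add h1).const_mul a
  rw [zero_add] at h3
  refine h3.congr' ?_
  filter_upwards [eventually_gt_atTop 1] with z hz
  have hint : ∀ u v : ℝ,
      IntervalIntegrable (fun t => survival P V t * t ^ (a - 1)) volume u v := by
    intro u v
    refine (intervalIntegral.intervalIntegrable_rpow' (r := a - 1) (by linarith)).mono_fun
      (Measurable.aestronglyMeasurable (by fun_prop)) (Eventually.of_forall fun t => ?_)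
    simp only [norm_mul, Real.norm_of_nonneg (survival_nonneg _ _ _)]
    exact mul_le_of_le_one_left (norm_nonneg _) (survival_le_one _ _ _)
  rw [integral_min_rpow hV hV0 ha (by linarith),
    ← intervalIntegral.integral_add_adjacent_intervals (hint 0 1) (hint 1 z), ← add_div]
  have e : ∫ t in (1 : ℝ)..z, t ^ a * survival P V t / t =
      ∫ t in (1 : ℝ)..z, survival P V t * t ^ (a - 1) := by
    refine intervalIntegral.integral_congr fun t ht => ?_
    rw [uIcc_of_le hz.le] at ht
    have ht0 : 0 < t := one_pos.trans_le ht.1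
    simp only [Real.rpow_sub_one ht0.ne']
    ring
  rw [e]
  ring

/-- The product of two independent variables with power tails of the same index has a power tail
with a logarithmic correction. -/
theorem tendsto_survival_mul_div_log {W V : Ω → ℝ} (hW : Measurable W) (hV : Measurable V)
    (hV0 : ∀ ω, 0 ≤ V ω) (hind : IndepFun W V P) {a A B : ℝ} (ha : 0 < a)
    (hA : Tendsto (fun s => s ^ a * survival P W s) atTop (𝓝 A))
    (hB : Tendsto (fun s => s ^ a * survival P V s) atTop (𝓝 B)) :
    Tendsto (fun z => z ^ a * survival P (fun ω => W ω * V ω) z / Real.log z) atTop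
      (𝓝 (a * A * B)) := by
  obtain ⟨C, hC0, hC⟩ := rpow_mul_survival_bdd ha hB
  have hL := tendsto_integral_min_rpow_div_log hV hV0 ha hB
  set L : ℝ → ℝ := fun z => ∫ ω, (min (V ω) z) ^ a ∂P with hLdef
  have hm0 : ∀ z : ℝ, 0 ≤ z → ∀ ω, 0 ≤ min (V ω) z := fun z hz ω => le_min (hV0 ω) hz
  have hLint : ∀ z : ℝ, 0 ≤ z → Integrable (fun ω => (min (V ω) z) ^ a) P := by
    intro z hz
    refine Integrable.of_bound (Measurable.aestronglyMeasurable (by fun_prop)) (z ^ a)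
      (Eventually.of_forall fun ω => ?_)
    rw [Real.norm_of_nonneg (Real.rpow_nonneg (hm0 z hz ω) a)]
    exact Real.rpow_le_rpow (hm0 z hz ω) (min_le_right _ _) ha.le
  -- Split at `V = z / M`, where `M` is the threshold beyond which `s ^ a P(W > s)` is within `ε` of
  -- `A`. Below it the integrand is within `ε V ^ a` of `A V ^ a`. Above it the error is at most `(1
  -- + |A|) z ^ a`, on an event of probability at most `C (z / M) ^ (-a)`; this gives `K`.
  have hbound : ∀ ε > 0, ∃ K, ∀ z, 0 < z →
      |z ^ a * survival P (fun ω => W ω * V ω) z - A * L z| ≤ ε * L z + K := by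
    intro ε hε
    obtain ⟨M', hM'⟩ := (Metric.tendsto_atTop.1 hA) ε hε
    set M := max M' 1 with hM
    have hM1 : 1 ≤ M := le_max_right _ _
    have hM0 : 0 < M := one_pos.trans_le hM1
    refine ⟨(1 + |A|) * (M ^ a * C), fun z hz => ?_⟩
    have hza : 0 < z ^ a := Real.rpow_pos_of_pos hz a
    set f : Ω → ℝ := fun ω => V ω ^ a * ((z / V ω) ^ a * survival P W (z / V ω)) with hf
    have hf0 : ∀ ω, 0 ≤ f ω := fun ω => mul_nonneg (Real.rpow_nonneg (hV0 ω) a)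
      (mul_nonneg (Real.rpow_nonneg (div_nonneg hz.le (hV0 ω)) a) (survival_nonneg _ _ _))
    have hfz : ∀ ω, f ω ≤ z ^ a := by
      intro ω
      rcases (hV0 ω).eq_or_lt with h | h
      · simp only [hf, ← h, Real.zero_rpow ha.ne', zero_mul]
        exact hza.le
      · simp only [hf]
        rw [← mul_assoc, ← Real.mul_rpow h.le (by positivity), mul_div_cancel₀ _ h.ne']
        exact mul_le_of_le_one_right hza.le (survival_le_one _ _ _)
    have hfint : Integrable f P := by
      refine Integrable.of_bound (Measurable.aestronglyMeasurable (by fun_prop)) (z ^ a)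
        (Eventually.of_forall fun ω => ?_)
      rw [Real.norm_of_nonneg (hf0 ω)]
      exact hfz ω
    set E : Set Ω := {ω | z / M < V ω} with hE
    have hEm : MeasurableSet E := measurableSet_lt measurable_const hV
    have hpt : ∀ ω, ‖f ω - A * (min (V ω) z) ^ a‖ ≤
        ε * (min (V ω) z) ^ a + (1 + |A|) * z ^ a * E.indicator 1 ω := by
      intro ω
      have hmz : (min (V ω) z) ^ a ≤ z ^ a :=
        Real.rpow_le_rpow (hm0 z hz.le ω) (min_le_right _ _) ha.le
      have hmn := Real.rpow_nonneg (hm0 z hz.le ω) a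
      by_cases hω : ω ∈ E
      · rw [indicator_of_mem hω, Pi.one_apply, mul_one]
        refine (norm_sub_le _ _).trans ?_
        rw [Real.norm_of_nonneg (hf0 ω), norm_mul, Real.norm_of_nonneg hmn, Real.norm_eq_abs]
        have := mul_le_mul_of_nonneg_left hmz (abs_nonneg A)
        have := hfz ω
        have := mul_nonneg hε.le hmn
        linarith
      · have hVz : V ω ≤ z / M := not_lt.1 hω
        have hVz' : V ω ≤ z := hVz.trans (div_le_self hz.le hM1)
        rw [indicator_of_notMem hω, mul_zero, add_zero, min_eq_left hVz']
        rcases (hV0 ω).eq_or_lt with h | h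
        · simp [hf, ← h, Real.zero_rpow ha.ne']
        · have hMz : M ≤ z / V ω := by rwa [le_div_comm₀ hM0 h]
          have := (hM' (z / V ω) ((le_max_left _ _).trans hMz)).le
          rw [Real.dist_eq] at this
          have e : f ω - A * V ω ^ a =
              ((z / V ω) ^ a * survival P W (z / V ω) - A) * V ω ^ a := by
            simp only [hf]; ring
          rw [e, norm_mul, Real.norm_of_nonneg (Real.rpow_nonneg h.le a), Real.norm_eq_abs]
          gcongr
    rw [rpow_mul_survival_mul hW hV hV0 hind ha hz, hLdef]
    simp only
    rw [← integral_const_mul, ← integral_sub hfint ((hLint z hz.le).const_mul A)]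
    have hind1 : Integrable (E.indicator (1 : Ω → ℝ)) P :=
      (integrable_const (1 : ℝ)).indicator hEm
    refine (norm_integral_le_of_norm_le (((hLint z hz.le).const_mul ε).add
      (hind1.const_mul ((1 + |A|) * z ^ a))) (Eventually.of_forall hpt)).trans ?_
    simp only [Pi.add_apply]
    rw [integral_add ((hLint z hz.le).const_mul ε) (hind1.const_mul _), integral_const_mul,
      integral_const_mul, integral_indicator_one hEm]
    refine add_le_add le_rfl ?_
    rw [mul_assoc]
    refine mul_le_mul_of_nonneg_left ?_ (by positivity)
    have h1 := hC (z / M) (by positivity)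
    have h2 : z ^ a = M ^ a * (z / M) ^ a := by
      rw [← Real.mul_rpow hM0.le (by positivity), mul_div_cancel₀ _ hM0.ne']
    rw [h2, mul_assoc]
    exact mul_le_mul_of_nonneg_left h1 (by positivity)
  have hsub : Tendsto (fun z => (z ^ a * survival P (fun ω => W ω * V ω) z - A * L z) /
      Real.log z) atTop (𝓝 0) := by
    rw [Metric.tendsto_nhds]
    intro ε hε
    -- `D` strictly exceeds the limit of `L z / log z`, so tolerance `ε / (2 D)` costs less than `ε
    -- / 2` after division by `log z`.
    set D := |a * B| + 1 with hD
    have hDpos : 0 < D := by positivity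
    obtain ⟨K, hK⟩ := hbound (ε / (2 * D)) (by positivity)
    have hK0 : Tendsto (fun z => K / Real.log z) atTop (𝓝 0) :=
      tendsto_const_nhds.div_atTop Real.tendsto_log_atTop
    filter_upwards [hK0.eventually_lt_const (half_pos hε),
      hL.eventually_lt_const (show a * B < D by linarith [le_abs_self (a * B)]),
      eventually_gt_atTop 1] with z h1 h2 hz
    have hlog := Real.log_pos hz
    have h3 := hK z (by linarith)
    rw [Real.dist_eq, sub_zero, abs_div, abs_of_pos hlog]
    calc _ ≤ (ε / (2 * D) * L z + K) / Real.log z := by gcongr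
      _ = ε / (2 * D) * (L z / Real.log z) + K / Real.log z := by ring
      _ < ε / (2 * D) * D + ε / 2 := by gcongr
      _ = ε := by field_simp; ring
  have := hsub.add (hL.const_mul A)
  rw [zero_add, show A * (a * B) = a * A * B by ring] at this
  refine this.congr fun z => ?_
  ring

end Product

/-! ### Tails and moments of functions of a variable. -/

section Transfer

lemma tendsto_survival_rpow_inv {Ω : Type*} [MeasurableSpace Ω] {P : Measure Ω} {Y : Ω → ℝ} {α γ D c : ℝ} (hγ : 0 < γ) (hc : 0 < c)
    (hY : Tendsto (fun s => s ^ α * survival P Y s) atTop (𝓝 D)) :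
    Tendsto (fun s => s ^ (α / γ) * survival P Y ((s / c) ^ (1 / γ))) atTop
      (𝓝 (c ^ (α / γ) * D)) := by
  have hu : Tendsto (fun s : ℝ => (s / c) ^ (1 / γ)) atTop atTop :=
    (tendsto_rpow_atTop (by positivity)).comp (tendsto_id.atTop_div_const hc)
  refine ((hY.comp hu).const_mul (c ^ (α / γ))).congr' ?_
  filter_upwards [eventually_gt_atTop 0] with s hs
  have hsc : 0 ≤ s / c := by positivity
  simp only [Function.comp]
  rw [← Real.rpow_mul hsc, ← mul_assoc, show 1 / γ * α = α / γ by ring,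
    ← Real.mul_rpow hc.le hsc, mul_div_cancel₀ _ hc.ne']

variable {Ω : Type*} [MeasurableSpace Ω] {P : Measure Ω} [IsProbabilityMeasure P]

/-- For large positive `Y`, `|f(Y)|` lies between `c Y ^ γ` with `c` just below and just above `ℓ`,
and the tail of `c Y ^ γ` is explicit. When `ℓ = 0` the lower bound is trivial. -/
lemma tendsto_tail_comp_of_pos {Y : Ω → ℝ} {f : ℝ → ℝ} (hf : Continuous f) {α γ D ℓ : ℝ}
    (hα : 0 < α) (hγ : 0 < γ) (hℓ : 0 ≤ ℓ)
    (hY : Tendsto (fun s => s ^ α * survival P Y s) atTop (𝓝 D))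
    (hfl : Tendsto (fun z => |f z| / z ^ γ) atTop (𝓝 ℓ)) :
    Tendsto (fun s => s ^ (α / γ) * P.real {ω | 0 < Y ω ∧ s < |f (Y ω)|}) atTop
      (𝓝 (ℓ ^ (α / γ) * D)) := by
  have hp : 0 < α / γ := by positivity
  have hcont : Tendsto (fun c : ℝ => c ^ (α / γ) * D) (𝓝 ℓ) (𝓝 (ℓ ^ (α / γ) * D)) :=
    ((Real.continuousAt_rpow_const ℓ _ (Or.inr hp.le)).mul_const D).tendsto
  refine tendsto_order.2 ⟨fun y hy => ?_, fun y hy => ?_⟩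
  · rcases hℓ.eq_or_lt with rfl | hℓ
    · rw [Real.zero_rpow hp.ne', zero_mul] at hy
      filter_upwards [eventually_gt_atTop 0] with s hs
      exact hy.trans_le (by positivity)
    obtain ⟨c, ⟨hyc, hc0⟩, hcl⟩ :=
      ((((hcont.mono_left nhdsWithin_le_nhds).eventually_const_lt hy).and
      (nhdsWithin_le_nhds (Ioi_mem_nhds hℓ))).and
      (self_mem_nhdsWithin : Iio ℓ ∈ 𝓝[<] ℓ)).exists
    obtain ⟨R, hR⟩ := eventually_atTop.1 (hfl.eventually_const_lt hcl)
    have hu : Tendsto (fun s : ℝ => (s / c) ^ (1 / γ)) atTop atTop :=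
      (tendsto_rpow_atTop (by positivity)).comp (tendsto_id.atTop_div_const hc0)
    filter_upwards [(tendsto_survival_rpow_inv hγ hc0 hY).eventually_const_lt hyc,
      eventually_gt_atTop 0, hu.eventually_ge_atTop R] with s hs hs0 hsR
    refine hs.trans_le ?_
    have hc0' : 0 < c := hc0
    refine mul_le_mul_of_nonneg_left (measureReal_mono fun ω hω => ?_) (by positivity)
    have hω : (s / c) ^ (1 / γ) < Y ω := hω
    have hpos : 0 ≤ (s / c) ^ (1 / γ) := by positivity
    have hY0 : 0 < Y ω := hpos.trans_lt hω
    refine ⟨hY0, ?_⟩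
    have h1 := hR (Y ω) (hsR.trans hω.le)
    rw [lt_div_iff₀ (by positivity)] at h1
    refine lt_trans ?_ h1
    have h2 := Real.rpow_lt_rpow hpos hω hγ
    rw [← Real.rpow_mul (by positivity), one_div_mul_cancel hγ.ne', Real.rpow_one,
      div_lt_iff₀ hc0'] at h2
    linarith
  · obtain ⟨c, hyc, hcl⟩ := (((hcont.mono_left nhdsWithin_le_nhds).eventually_lt_const hy).and
      (self_mem_nhdsWithin : Ioi ℓ ∈ 𝓝[>] ℓ)).exists
    have hc0 : 0 < c := hℓ.trans_lt hcl
    obtain ⟨R, hR⟩ := eventually_atTop.1 (hfl.eventually_lt_const hcl)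
    -- Once `s > K`, the event forces `Y` out of `[0, R]`, into the range where the growth estimate
    -- holds.
    obtain ⟨K, hK⟩ := (isCompact_Icc (a := (0 : ℝ)) (b := R)).exists_bound_of_continuousOn
      hf.continuousOn
    filter_upwards [(tendsto_survival_rpow_inv hγ hc0 hY).eventually_lt_const hyc,
      eventually_gt_atTop 0, eventually_gt_atTop K] with s hs hs0 hsK
    refine lt_of_le_of_lt ?_ hs
    refine mul_le_mul_of_nonneg_left (measureReal_mono fun ω hω => ?_) (by positivity)
    obtain ⟨hY0, hsf⟩ := hω
    have hRY : R ≤ Y ω := by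
      by_contra hlt
      have := hK (Y ω) ⟨hY0.le, (not_le.1 hlt).le⟩
      rw [Real.norm_eq_abs] at this
      linarith
    have h1 := hR (Y ω) hRY
    rw [div_lt_iff₀ (by positivity)] at h1
    have h2 : s / c < Y ω ^ γ := by
      rw [div_lt_iff₀ hc0]
      linarith
    have h3 := Real.rpow_lt_rpow (by positivity) h2 (one_div_pos.2 hγ)
    rwa [← Real.rpow_mul hY0.le, mul_one_div_cancel hγ.ne', Real.rpow_one] at h3

/-- The tail of `|f (Y)|` when both tails of `Y` are power tails and `f` has power growth. -/
theorem tendsto_survival_abs_comp {Y : Ω → ℝ} (hYm : Measurable Y) {f : ℝ → ℝ} (hf : Continuous f)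
    {α γ D ℓ₁ ℓ₂ : ℝ} (hα : 0 < α) (hγ : 0 < γ) (hℓ₁ : 0 ≤ ℓ₁) (hℓ₂ : 0 ≤ ℓ₂)
    (hY : Tendsto (fun s => s ^ α * survival P Y s) atTop (𝓝 D))
    (hY' : Tendsto (fun s => s ^ α * survival P (fun ω => -Y ω) s) atTop (𝓝 D))
    (h₁ : Tendsto (fun z => |f z| / z ^ γ) atTop (𝓝 ℓ₁))
    (h₂ : Tendsto (fun z => |f (-z)| / z ^ γ) atTop (𝓝 ℓ₂)) :
    Tendsto (fun s => s ^ (α / γ) * survival P (fun ω => |f (Y ω)|) s) atTop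
      (𝓝 ((ℓ₁ ^ (α / γ) + ℓ₂ ^ (α / γ)) * D)) := by
  have h := (tendsto_tail_comp_of_pos hf hα hγ hℓ₁ hY h₁).add
    (tendsto_tail_comp_of_pos (hf.comp continuous_neg) hα hγ hℓ₂ hY' h₂)
  rw [← add_mul] at h
  refine h.congr' ?_
  -- For such `s` the value `Y = 0` does not contribute, so the event splits according to the sign
  -- of `Y`.
  filter_upwards [eventually_ge_atTop |f 0|] with s hs
  rw [← mul_add]
  congr 1
  simp only [Function.comp, neg_neg]
  have hm : Measurable fun ω => f (Y ω) := hf.measurable.comp hYm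
  rw [← measureReal_union, survival]
  · congr 1
    ext ω
    simp only [mem_union, mem_ofPred_eq]
    constructor
    · rintro (h | h) <;> exact h.2
    · intro h
      rcases lt_trichotomy (Y ω) 0 with h0 | h0 | h0
      · exact Or.inr ⟨by linarith, h⟩
      · rw [h0] at h
        exact absurd h (not_lt.2 hs)
      · exact Or.inl ⟨h0, h⟩
  · refine Set.disjoint_left.2 fun ω h1 h2 => ?_
    have := h1.1
    have := h2.1
    linarith
  · exact (measurableSet_lt measurable_const hYm.neg).inter
      (measurableSet_lt measurable_const hm.abs)

lemma integrable_rpow_of_survival_le {V : Ω → ℝ} (hV : Measurable V) (hV0 : ∀ ω, 0 ≤ V ω)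
    {a q C : ℝ} (hq : 0 < q) (hqa : q < a) (hC : ∀ s, 1 ≤ s → survival P V s ≤ C * s ^ (-a)) :
    Integrable (fun ω => V ω ^ q) P := by
  have hint : IntegrableOn (fun t => survival P V t * t ^ (q - 1)) (Ioi 0) := by
    rw [← Ioc_union_Ioi_eq_Ioi (zero_le_one' ℝ)]
    refine IntegrableOn.union ?_ ?_
    · have h : IntegrableOn (fun t : ℝ => t ^ (q - 1)) (Ioc 0 1) :=
        (intervalIntegral.intervalIntegrable_rpow' (by linarith)).1
      refine h.mono' (Measurable.aestronglyMeasurable (by fun_prop)) ?_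
      filter_upwards [ae_restrict_mem measurableSet_Ioc] with t ht
      have ht0 : 0 < t := ht.1
      rw [Real.norm_of_nonneg (mul_nonneg (survival_nonneg _ _ _) (by positivity))]
      exact mul_le_of_le_one_left (by positivity) (survival_le_one _ _ _)
    · have h : IntegrableOn (fun t : ℝ => C * t ^ (q - 1 - a)) (Ioi 1) :=
        (integrableOn_Ioi_rpow_of_lt (by linarith) one_pos).const_mul C
      refine h.mono' (Measurable.aestronglyMeasurable (by fun_prop)) ?_
      filter_upwards [ae_restrict_mem measurableSet_Ioi] with t (ht : 1 < t)
      have ht0 : 0 < t := one_pos.trans ht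
      rw [Real.norm_of_nonneg (mul_nonneg (survival_nonneg _ _ _) (by positivity))]
      calc _ ≤ C * t ^ (-a) * t ^ (q - 1) := by gcongr; exact hC t ht.le
        _ = C * t ^ (q - 1 - a) := by rw [mul_assoc, ← Real.rpow_add ht0]; ring_nf
  refine ⟨Measurable.aestronglyMeasurable (by fun_prop), ?_⟩
  rw [hasFiniteIntegral_iff_ofReal (Eventually.of_forall fun ω => Real.rpow_nonneg (hV0 ω) q),
    lintegral_rpow_eq_lintegral_meas_lt_mul P (Eventually.of_forall hV0) hV.aemeasurable hq]
  refine ENNReal.mul_lt_top ENNReal.ofReal_lt_top ?_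
  have e : ∀ t ∈ Ioi (0 : ℝ), P {ω | t < V ω} * ENNReal.ofReal (t ^ (q - 1)) =
      ENNReal.ofReal (survival P V t * t ^ (q - 1)) := fun t ht => by
    rw [ENNReal.ofReal_mul (survival_nonneg _ _ _), survival, ofReal_measureReal]
  rw [setLIntegral_congr_fun measurableSet_Ioi e]
  exact hint.lintegral_lt_top

end Transfer

/-! ### Moments under polynomial growth. -/

section Growth

lemma exists_bound_of_isBigO {f : ℝ → ℝ} (hf : Continuous f) {b : ℝ}
    (h₁ : (fun z => |f z|) =O[atTop] fun z => z ^ b)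
    (h₂ : (fun z => |f (-z)|) =O[atTop] fun z => z ^ b) :
    ∃ K, 0 ≤ K ∧ ∀ z, |f z| ≤ K * max 1 (|z| ^ b) := by
  obtain ⟨c₁, hc₁⟩ := h₁.bound
  obtain ⟨c₂, hc₂⟩ := h₂.bound
  obtain ⟨R, hR⟩ := eventually_atTop.1 (hc₁.and hc₂)
  set S := max R 0
  obtain ⟨K, hK⟩ := (isCompact_Icc (a := -S) (b := S)).exists_bound_of_continuousOn
    hf.continuousOn
  set M := max 0 (max K (max c₁ c₂))
  have hM0 : 0 ≤ M := le_max_left _ _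
  have hMK : K ≤ M := (le_max_left _ _).trans (le_max_right _ _)
  have hM1 : c₁ ≤ M := ((le_max_left _ _).trans (le_max_right _ _)).trans (le_max_right _ _)
  have hM2 : c₂ ≤ M := ((le_max_right _ _).trans (le_max_right _ _)).trans (le_max_right _ _)
  have key : ∀ z c : ℝ, c ≤ M → |f z| ≤ c * |z| ^ b → |f z| ≤ M * max 1 (|z| ^ b) := by
    intro z c hc h
    have : 0 ≤ |z| ^ b := by positivity
    exact h.trans (mul_le_mul hc (le_max_right _ _) this hM0)
  refine ⟨M, hM0, fun z => ?_⟩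
  rcases le_or_gt |z| S with hz | hz
  · have := hK z (abs_le.1 hz)
    rw [Real.norm_eq_abs] at this
    exact (this.trans hMK).trans (le_mul_of_one_le_right hM0 (le_max_left _ _))
  · have hzR : R ≤ |z| := (le_max_left _ _).trans hz.le
    obtain ⟨ha, hb⟩ := hR |z| hzR
    rw [Real.norm_eq_abs, Real.norm_eq_abs, abs_abs,
      abs_of_nonneg (Real.rpow_nonneg (abs_nonneg z) b)] at ha hb
    rcases abs_choice z with h | h
    · exact key z c₁ hM1 (by rw [h] at ha ⊢; exact ha)
    · exact key z c₂ hM2 (by rw [h, neg_neg] at hb; rw [h]; exact hb)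

variable {Ω : Type*} [MeasurableSpace Ω] {P : Measure Ω} [IsProbabilityMeasure P]

lemma integrable_abs_comp_rpow {Y : Ω → ℝ} (hY : Measurable Y) {f : ℝ → ℝ} (hf : Continuous f)
    {b p α : ℝ} (hb : 0 ≤ b) (hp : 0 < p) (hbp : b * p < α)
    (hmom : ∀ q, 0 < q → q < α → Integrable (fun ω => |Y ω| ^ q) P)
    (h₁ : (fun z => |f z|) =O[atTop] fun z => z ^ b)
    (h₂ : (fun z => |f (-z)|) =O[atTop] fun z => z ^ b) :
    Integrable (fun ω => |f (Y ω)| ^ p) P := by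
  obtain ⟨K, hK0, hK⟩ := exists_bound_of_isBigO hf h₁ h₂
  have hm : Measurable fun ω => f (Y ω) := hf.measurable.comp hY
  have hint : Integrable (fun ω => |Y ω| ^ (b * p)) P := by
    -- `hmom` covers positive exponents only; for `b = 0` the function is constant.
    rcases (mul_nonneg hb hp.le).eq_or_lt with h | h
    · simp [← h]
    · exact hmom _ h hbp
  refine (((integrable_const (1 : ℝ)).add hint).const_mul (K ^ p)).mono'
    (Measurable.aestronglyMeasurable (by fun_prop)) (Eventually.of_forall fun ω => ?_)
  rw [Real.norm_of_nonneg (by positivity)]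
  calc |f (Y ω)| ^ p ≤ (K * max 1 (|Y ω| ^ b)) ^ p := by gcongr; exact hK _
    _ = K ^ p * (max 1 (|Y ω| ^ b)) ^ p := Real.mul_rpow hK0 (by positivity)
    _ ≤ K ^ p * (1 + |Y ω| ^ (b * p)) := by
      gcongr
      have h0 : 0 ≤ |Y ω| ^ (b * p) := by positivity
      rcases max_choice 1 (|Y ω| ^ b) with h | h
      · rw [h, Real.one_rpow]
        linarith
      · rw [h, ← Real.rpow_mul (abs_nonneg _)]
        linarith

end Growth

/-! ### Moment bound and full support of stable laws, including `α = 2`. -/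

section Stable

variable {μ : Measure ℝ} [IsProbabilityMeasure μ] {α σ : ℝ}

/-- The truncation inequality bounds the tail by the mean of `1 - φ` near 0. It is cruder than the
exact tail but also covers `α = 2`, which suffices for moments. -/
lemma measureReal_abs_gt_le_of_stable (h0 : 0 < α) (hσ : 0 < σ)
    (hμ : ∀ t, charFun μ t = (stableChar α σ t : ℂ)) {r : ℝ} (hr : 0 < r) :
    μ.real {x | r < |x|} ≤ 2 * σ ^ α * 2 ^ α * r ^ (-α) := by
  refine (measureReal_abs_gt_le_integral_charFun hr).trans ?_
  have h : ‖∫ t in (-2 * r⁻¹)..(2 * r⁻¹), 1 - charFun μ t‖ ≤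
      σ ^ α * (2 * r⁻¹) ^ α * |2 * r⁻¹ - -2 * r⁻¹| := by
    refine intervalIntegral.norm_integral_le_of_norm_le_const fun t ht => ?_
    rw [uIoc_of_le (by nlinarith [inv_pos.2 hr])] at ht
    have habs : |t| ≤ 2 * r⁻¹ := abs_le.2 ⟨by linarith [ht.1], ht.2⟩
    rw [hμ, ← Complex.ofReal_one, ← Complex.ofReal_sub, Complex.norm_real,
      Real.norm_of_nonneg (by linarith [stableChar_le_one (α := α) hσ t])]
    exact (one_sub_stableChar_le t).trans (by gcongr)
  rw [show 2 * r⁻¹ - -2 * r⁻¹ = 4 * r⁻¹ by ring, abs_of_pos (by positivity),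
    Real.mul_rpow (by positivity) (by positivity), Real.inv_rpow hr.le, ← Real.rpow_neg hr.le] at h
  calc _ ≤ 2⁻¹ * r * (σ ^ α * (2 ^ α * r ^ (-α)) * (4 * r⁻¹)) := by gcongr
    _ = _ := by field_simp; ring

/-- Stability: if `X`, `X'` are independent with law `μ`, then `a X + b X'` again has law `μ`.
Positive mass on `A` and `B` thus propagates to `S`. -/
lemma stable_mul_le (hμ : ∀ t, charFun μ t = (stableChar α σ t : ℂ)) {a b : ℝ}
    (hab : |a| ^ α + |b| ^ α = 1) {A B S : Set ℝ} (hS : MeasurableSet S)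
    (h : ∀ x ∈ A, ∀ y ∈ B, a * x + b * y ∈ S) : μ A * μ B ≤ μ S := by
  have hconv : (μ.map (fun x => a * x)) ∗ (μ.map (fun x => b * x)) = μ := by
    have : IsProbabilityMeasure (μ.map (fun x => a * x)) :=
      Measure.isProbabilityMeasure_map (by fun_prop)
    have : IsProbabilityMeasure (μ.map (fun x => b * x)) :=
      Measure.isProbabilityMeasure_map (by fun_prop)
    refine Measure.ext_of_charFun (funext fun t => ?_)
    rw [charFun_conv, charFun_map_mul, charFun_map_mul, hμ, hμ, hμ, ← Complex.ofReal_mul]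
    congr 1
    simp only [stableChar]
    rw [← Real.exp_add, abs_mul, abs_mul, Real.mul_rpow (abs_nonneg _) (abs_nonneg _),
      Real.mul_rpow (abs_nonneg _) (abs_nonneg _)]
    congr 1
    linear_combination (-(σ ^ α * |t| ^ α)) * hab
  have e : μ S = (μ.prod μ) {p | a * p.1 + b * p.2 ∈ S} := by
    conv_lhs => rw [← hconv]
    rw [Measure.conv, Measure.map_apply (by fun_prop) hS,
      Measure.map_prod_map _ _ (by fun_prop) (by fun_prop),
      Measure.map_apply (by fun_prop) (hS.preimage (by fun_prop))]
    rfl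
  rw [e, ← Measure.prod_prod]
  exact measure_mono fun p hp => h _ hp.1 _ hp.2

lemma stable_Ioi_pos (h0 : 0 < α) (h2 : α ≤ 2) (hσ : 0 < σ)
    (hμ : ∀ t, charFun μ t = (stableChar α σ t : ℂ)) (M : ℝ) : 0 < μ (Ioi M) := by
  rcases h2.eq_or_lt with rfl | h2
  -- Matching `exp (-σ ^ 2 t ^ 2)` with `exp (-v t ^ 2 / 2)` makes the law Gaussian of variance `2 σ
  -- ^ 2`.
  · obtain ⟨v, hv⟩ : ∃ v : NNReal, (v : ℝ) = 2 * σ ^ 2 := ⟨⟨2 * σ ^ 2, by positivity⟩, rfl⟩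
    have hv0 : v ≠ 0 := by
      rw [← NNReal.coe_ne_zero, hv]
      positivity
    have e : μ = gaussianReal 0 v := by
      refine Measure.ext_of_charFun (funext fun t => ?_)
      have hv' : (v : ℂ) = 2 * (σ : ℂ) ^ 2 := by exact_mod_cast congrArg Complex.ofReal hv
      rw [hμ, charFun_gaussianReal, stableChar, Complex.ofReal_exp, hv']
      congr 1
      simp only [Real.rpow_two, sq_abs]
      push_cast
      ring
    have := (gaussianReal_absolutelyContinuous' 0 hv0).isOpenPosMeasure
    rw [e]
    exact isOpen_Ioi.measure_pos _ nonempty_Ioi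
  · have hpos : 0 < tailConst α * σ ^ α / 2 := by
      have := tailConst_pos h0 h2
      positivity
    obtain ⟨r, ⟨hr, hr0⟩, hrM⟩ := (((tendsto_rpow_mul_tail h0 h2 hσ hμ).eventually_const_lt
      hpos).and (eventually_gt_atTop 0) |>.and (eventually_ge_atTop M)).exists
    have hr' : 0 < μ.real (Ioi r) := (pos_iff_pos_of_mul_pos hr).1 (by positivity)
    exact (ENNReal.toReal_pos_iff.1 hr').1.trans_le (measure_mono (Ioi_subset_Ioi hrM))

/-- A symmetric stable law charges every nonempty open set. -/
lemma stable_isOpenPosMeasure (h0 : 0 < α) (h2 : α ≤ 2) (hσ : 0 < σ)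
    (hμ : ∀ t, charFun μ t = (stableChar α σ t : ℂ)) : μ.IsOpenPosMeasure := by
  -- Some point `x` has all its neighbourhoods charged; two independent copies near `x` make `c (X -
  -- X')` small, with `2 c ^ α = 1`.
  have hzero : ∀ ε > 0, 0 < μ (Metric.ball 0 ε) := by
    intro ε hε
    obtain ⟨x, -, hx⟩ := exists_mem_forall_mem_nhdsWithin_pos_measure (μ := μ) (s := univ)
      (by simp)
    have hxpos : 0 < μ (Metric.ball x (ε / 2)) :=
      hx _ (by rw [nhdsWithin_univ]; exact Metric.ball_mem_nhds x (by positivity))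
    set c : ℝ := (1 / 2) ^ (1 / α)
    have hc0 : 0 < c := by positivity
    have hc1 : c ≤ 1 := Real.rpow_le_one (by norm_num) (by norm_num) (by positivity)
    have hcα : c ^ α = 1 / 2 := by
      rw [← Real.rpow_mul (by norm_num), one_div_mul_cancel h0.ne', Real.rpow_one]
    refine (ENNReal.mul_pos hxpos.ne' hxpos.ne').trans_le
      (stable_mul_le hμ (a := c) (b := -c) ?_ measurableSet_ball fun u hu v hv => ?_)
    · rw [abs_neg, abs_of_pos hc0, hcα]
      norm_num
    · rw [Metric.mem_ball, Real.dist_eq, abs_lt] at hu hv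
      rw [mem_ball_zero_iff, Real.norm_eq_abs, show c * u + -c * v = c * (u - v) by ring, abs_mul,
        abs_of_pos hc0]
      have : |u - v| < ε := abs_lt.2 ⟨by linarith, by linarith⟩
      nlinarith [abs_nonneg (u - v)]
  refine ⟨fun U hU ⟨z, hz⟩ => ?_⟩
  obtain ⟨ε, hε, hεU⟩ := Metric.isOpen_iff.1 hU z hz
  -- Pick a support point `x > |z|`, so that `z = b x` with `|b| ≤ 1`. Then `a X + b X'` is near `z`
  -- when `X` is near 0 and `X'` near `x`, where `a ^ α = 1 - |b| ^ α`.
  obtain ⟨x, hxM, hx⟩ := exists_mem_forall_mem_nhdsWithin_pos_measure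
    (stable_Ioi_pos h0 h2 hσ hμ |z|).ne'
  have hxM : |z| < x := hxM
  have hx0 : 0 < x := (abs_nonneg z).trans_lt hxM
  have hxpos : 0 < μ (Metric.ball x (ε / 2)) :=
    hx _ (nhdsWithin_le_nhds (Metric.ball_mem_nhds x (by positivity)))
  set b := z / x
  have hb : |b| ≤ 1 := by
    rw [abs_div, abs_of_pos hx0]
    exact (div_le_one hx0).2 hxM.le
  have hbα : |b| ^ α ≤ 1 := Real.rpow_le_one (abs_nonneg _) hb h0.le
  have hbα0 : 0 ≤ |b| ^ α := by positivity
  set a := (1 - |b| ^ α) ^ (1 / α)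
  have ha0 : 0 ≤ a := Real.rpow_nonneg (by linarith) _
  have ha1 : a ≤ 1 := Real.rpow_le_one (by linarith) (by linarith) (by positivity)
  have haα : a ^ α = 1 - |b| ^ α := by
    rw [← Real.rpow_mul (by linarith), one_div_mul_cancel h0.ne', Real.rpow_one]
  refine ((ENNReal.mul_pos (hzero (ε / 2) (by positivity)).ne' hxpos.ne').trans_le
      (stable_mul_le hμ (a := a) (b := b) ?_ hU.measurableSet fun u hu v hv => hεU ?_)).ne'
  · rw [abs_of_nonneg ha0, haα]
    ring
  · rw [mem_ball_zero_iff, Real.norm_eq_abs] at hu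
    rw [Metric.mem_ball, Real.dist_eq] at hv ⊢
    have e : a * u + b * v - z = a * u + b * (v - x) := by
      simp only [b]
      field_simp
      ring
    rw [e]
    refine (abs_add_le _ _).trans_lt ?_
    rw [abs_mul, abs_mul, abs_of_nonneg ha0]
    nlinarith [abs_nonneg u, abs_nonneg (v - x)]

end Stable

/-! ### The preceding results for stable random variables. -/

section StableVariable

lemma IsSymmStable.neg {Ω : Type*} [MeasurableSpace Ω] {P : Measure Ω} {X : Ω → ℝ} {α σ : ℝ}
    (h : IsSymmStable P X α σ) : IsSymmStable P (fun ω => -X ω) α σ := by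
  refine ⟨h.measurable.neg, h.index_pos, h.index_le_two, h.scale_pos, fun t => ?_⟩
  have e : P.map (fun ω => -X ω) = (P.map X).map (fun x => (-1) * x) := by
    rw [Measure.map_map (by fun_prop) h.measurable]
    congr 1
    ext ω
    simp
  rw [e, charFun_map_mul, h.charFun_eq]
  simp

variable {Ω : Type*} [MeasurableSpace Ω] {P : Measure Ω} [IsProbabilityMeasure P]
  {X : Ω → ℝ} {α σ : ℝ}

lemma IsSymmStable.isProbabilityMeasure_map (h : IsSymmStable P X α σ) :
    IsProbabilityMeasure (P.map X) := Measure.isProbabilityMeasure_map h.measurable.aemeasurable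

lemma IsSymmStable.tendsto_survival (h : IsSymmStable P X α σ) (h2 : α < 2) :
    Tendsto (fun s => s ^ α * survival P X s) atTop (𝓝 (tailConst α * σ ^ α / 2)) := by
  have := h.isProbabilityMeasure_map
  refine (tendsto_rpow_mul_tail h.index_pos h2 h.scale_pos h.charFun_eq).congr fun s => ?_
  rw [map_measureReal_apply h.measurable measurableSet_Ioi]
  rfl

lemma IsSymmStable.tendsto_survival_abs_comp (h : IsSymmStable P X α σ) (h2 : α < 2)
    {f : ℝ → ℝ} (hf : Continuous f) {γ ℓ : ℝ} (hγ : 0 < γ) (hℓ : 0 ≤ ℓ)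
    (h₁ : Tendsto (fun z => |f z| / z ^ γ) atTop (𝓝 1))
    (h₂ : Tendsto (fun z => |f (-z)| / z ^ γ) atTop (𝓝 ℓ)) :
    Tendsto (fun s => s ^ (α / γ) * survival P (fun ω => |f (X ω)|) s) atTop
      (𝓝 ((1 + ℓ ^ (α / γ)) / 2 * (tailConst α * σ ^ α))) := by
  have := StableTail.tendsto_survival_abs_comp h.measurable hf h.index_pos hγ zero_le_one hℓ
    (h.tendsto_survival h2) (h.neg.tendsto_survival h2) h₁ h₂
  rw [Real.one_rpow] at this
  convert this using 2
  ring

lemma IsSymmStable.tendsto_survival_abs (h : IsSymmStable P X α σ) (h2 : α < 2) :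
    Tendsto (fun s => s ^ α * survival P (fun ω => |X ω|) s) atTop
      (𝓝 (tailConst α * σ ^ α)) := by
  have h1 : Tendsto (fun z : ℝ => |z| / z ^ (1 : ℝ)) atTop (𝓝 1) := by
    refine tendsto_const_nhds.congr' ?_
    filter_upwards [eventually_gt_atTop 0] with z hz
    rw [Real.rpow_one, abs_of_pos hz, div_self hz.ne']
  have := h.tendsto_survival_abs_comp h2 continuous_id one_pos zero_le_one h1
    (by simpa using h1)
  simpa using this

lemma IsSymmStable.integrable_abs_rpow (h : IsSymmStable P X α σ) {q : ℝ} (hq : 0 < q)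
    (hqα : q < α) : Integrable (fun ω => |X ω| ^ q) P := by
  have := h.isProbabilityMeasure_map
  refine integrable_rpow_of_survival_le h.measurable.abs (fun ω => abs_nonneg _) hq hqα
    (C := 2 * σ ^ α * 2 ^ α) fun s hs => ?_
  have hb := measureReal_abs_gt_le_of_stable h.index_pos h.scale_pos h.charFun_eq
    (one_pos.trans_le hs)
  rwa [map_measureReal_apply h.measurable (measurableSet_lt measurable_const (by fun_prop))] at hb

/-- The set where `f` does not vanish is open and nonempty, hence charged by the stable law. -/
lemma IsSymmStable.integral_abs_comp_rpow_pos (h : IsSymmStable P X α σ) {f : ℝ → ℝ}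
    (hf : Continuous f) (hne : ∃ y, f y ≠ 0) {p : ℝ}
    (hint : Integrable (fun ω => |f (X ω)| ^ p) P) : 0 < ∫ ω, |f (X ω)| ^ p ∂P := by
  have := h.isProbabilityMeasure_map
  have := stable_isOpenPosMeasure h.index_pos h.index_le_two h.scale_pos h.charFun_eq
  have hU : IsOpen {y | f y ≠ 0} := isOpen_ne_fun hf continuous_const
  have hpos := hU.measure_pos (P.map X) hne
  rw [Measure.map_apply h.measurable hU.measurableSet] at hpos
  rw [integral_pos_iff_support_of_nonneg (fun ω => by positivity) hint]
  refine hpos.trans_le (measure_mono fun ω hω => ?_)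
  have := abs_pos.2 (show f (X ω) ≠ 0 from hω)
  exact (Real.rpow_pos_of_pos this p).ne'

end StableVariable

/-! ### From limits to equivalents and regular variation. -/

section Asymptotic

lemma asympEq_of_tendsto {S : ℝ → ℝ} {a c : ℝ} (hc : c ≠ 0)
    (h : Tendsto (fun z => z ^ a * S z) atTop (𝓝 c)) :
    AsympEq atTop S (fun z => c * z ^ (-a)) := by
  have := h.div_const c
  rw [div_self hc] at this
  refine this.congr' ?_
  filter_upwards [eventually_gt_atTop 0] with z hz
  have : 0 < z ^ a := Real.rpow_pos_of_pos hz a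
  rw [Real.rpow_neg hz.le]
  field_simp

lemma asympEq_log_of_tendsto {S : ℝ → ℝ} {a c : ℝ} (hc : c ≠ 0)
    (h : Tendsto (fun z => z ^ a * S z / Real.log z) atTop (𝓝 c)) :
    AsympEq atTop S (fun z => c * z ^ (-a) * Real.log z) := by
  have := h.div_const c
  rw [div_self hc] at this
  refine this.congr' ?_
  filter_upwards [eventually_gt_atTop 1] with z hz
  have hz0 := one_pos.trans hz
  have := Real.log_pos hz
  have : 0 < z ^ a := Real.rpow_pos_of_pos hz0 a
  rw [Real.rpow_neg hz0.le]
  field_simp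

lemma RegularlyVarying.of_asympEq {S T : ℝ → ℝ} {ρ : ℝ} (hST : AsympEq atTop S T)
    (hT : RegularlyVarying T ρ) (h0 : ∀ᶠ z in atTop, T z ≠ 0) : RegularlyVarying S ρ := by
  intro y hy
  have hmul : Tendsto (fun t : ℝ => y * t) atTop atTop := tendsto_id.const_mul_atTop hy
  have h1 := ((hST.comp hmul).mul (hT y hy)).mul (hST.inv₀ one_ne_zero)
  rw [one_mul, inv_one, mul_one] at h1
  refine h1.congr' ?_
  filter_upwards [h0, hmul.eventually h0] with t ht hyt
  simp only [Function.comp]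
  field_simp

lemma regularlyVarying_rpow {c a : ℝ} (hc : c ≠ 0) :
    RegularlyVarying (fun z => c * z ^ (-a)) (-a) := by
  intro y hy
  refine tendsto_const_nhds.congr' ?_
  filter_upwards [eventually_gt_atTop 0] with t ht
  have := (Real.rpow_pos_of_pos ht (-a)).ne'
  rw [Real.mul_rpow hy.le ht.le]
  field_simp

lemma regularlyVarying_rpow_mul_log {c a : ℝ} (hc : c ≠ 0) :
    RegularlyVarying (fun z => c * z ^ (-a) * Real.log z) (-a) := by
  intro y hy
  have h : Tendsto (fun t => y ^ (-a) * (Real.log y / Real.log t + 1)) atTop (𝓝 (y ^ (-a))) := by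
    have := ((tendsto_const_nhds (x := Real.log y)).div_atTop
      Real.tendsto_log_atTop).add_const 1 |>.const_mul (y ^ (-a))
    simpa using this
  refine h.congr' ?_
  filter_upwards [eventually_gt_atTop 1] with t ht
  have ht0 := one_pos.trans ht
  have := (Real.rpow_pos_of_pos ht0 (-a)).ne'
  have := (Real.log_pos ht).ne'
  rw [Real.mul_rpow hy.le ht0.le, Real.log_mul hy.ne' ht0.ne']
  field_simp

lemma regularlyVarying_and_asympEq {S : ℝ → ℝ} {a c : ℝ} (hc : c ≠ 0)
    (h : Tendsto (fun z => z ^ a * S z) atTop (𝓝 c)) :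
    RegularlyVarying S (-a) ∧ AsympEq atTop S (fun z => c * z ^ (-a)) := by
  refine ⟨.of_asympEq (asympEq_of_tendsto hc h) (regularlyVarying_rpow hc) ?_,
    asympEq_of_tendsto hc h⟩
  filter_upwards [eventually_gt_atTop 0] with z hz
  exact mul_ne_zero hc (Real.rpow_pos_of_pos hz _).ne'

lemma regularlyVarying_and_asympEq_log {S : ℝ → ℝ} {a c : ℝ} (hc : c ≠ 0)
    (h : Tendsto (fun z => z ^ a * S z / Real.log z) atTop (𝓝 c)) :
    RegularlyVarying S (-a) ∧ AsympEq atTop S (fun z => c * z ^ (-a) * Real.log z) := by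
  refine ⟨.of_asympEq (asympEq_log_of_tendsto hc h) (regularlyVarying_rpow_mul_log hc) ?_,
    asympEq_log_of_tendsto hc h⟩
  filter_upwards [eventually_gt_atTop 1] with z hz
  exact mul_ne_zero (mul_ne_zero hc (Real.rpow_pos_of_pos (one_pos.trans hz) _).ne')
    (Real.log_pos hz).ne'

end Asymptotic

/-! ### Growth of the activation functions. -/

section Activation

variable {τ : ℝ → ℝ} {β γ : ℝ}

lemma isBigO_of_mem_E1 (h : τ ∈ E1 β) :
    ((fun z => |τ z|) =O[atTop] fun z => z ^ β) ∧
      ((fun z => |τ (-z)|) =O[atTop] fun z => z ^ β) := by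
  obtain ⟨-, -, -, h₁, h₂⟩ := h
  have e : (fun z : ℝ => |z| ^ β) =ᶠ[atTop] fun z => z ^ β := by
    filter_upwards [eventually_ge_atTop 0] with z hz
    rw [abs_of_nonneg hz]
  refine ⟨h₁.trans_eventuallyEq e, ?_⟩
  have h3 := h₂.comp_tendsto tendsto_neg_atTop_atBot
  simp only [Function.comp_def, abs_neg] at h3
  exact h3.trans_eventuallyEq e

lemma isBigO_rpow_of_tendsto {f : ℝ → ℝ} {ℓ : ℝ}
    (h : Tendsto (fun z => |f z| / z ^ γ) atTop (𝓝 ℓ)) :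
    (fun z => |f z|) =O[atTop] fun z => z ^ γ := by
  refine isBigO_of_div_tendsto_nhds ?_ ℓ h
  filter_upwards [eventually_gt_atTop 0] with z hz h0
  exact absurd h0 (Real.rpow_pos_of_pos hz γ).ne'

lemma tendsto_neg_of_mem_E2 (h : τ ∈ E2 γ) :
    Tendsto (fun z => |τ (-z)| / z ^ γ) atTop (𝓝 1) := by
  refine (h.2.2.2.1.comp tendsto_neg_atTop_atBot).congr' ?_
  filter_upwards [eventually_ge_atTop 0] with z hz
  simp [abs_of_nonneg hz]

lemma tendsto_neg_of_mem_E3 (h : τ ∈ E3 γ) :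
    Tendsto (fun z => |τ (-z)| / z ^ γ) atTop (𝓝 0) := by
  obtain ⟨-, -, -, ⟨β, hβ, hO⟩, -⟩ := h
  obtain ⟨c, hc⟩ := (hO.comp_tendsto tendsto_neg_atTop_atBot).bound
  have hlim : Tendsto (fun z : ℝ => c * z ^ (-(γ - β))) atTop (𝓝 0) := by
    simpa using (tendsto_rpow_neg_atTop (sub_pos.2 hβ)).const_mul c
  refine squeeze_zero' ?_ ?_ hlim
  · filter_upwards [eventually_ge_atTop 0] with z hz
    positivity
  · filter_upwards [hc, eventually_gt_atTop 0] with z hz hz0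
    simp only [Function.comp, abs_neg, Real.norm_eq_abs, abs_abs] at hz
    rw [abs_of_pos hz0, abs_of_pos (Real.rpow_pos_of_pos hz0 β)] at hz
    rw [div_le_iff₀ (Real.rpow_pos_of_pos hz0 γ), mul_assoc, ← Real.rpow_add hz0]
    rwa [show -(γ - β) + γ = β by ring]

/-- For tails, the two classes differ only in the limit `ℓ` on the left: 1 for `E2`, 0 for `E3`.
Each tail of `Y` carries half the mass, so `c_τ = (1 + ℓ ^ p) / 2` for every `p > 0`. -/
lemma exists_tendsto_of_mem_E2_union_E3 (h : τ ∈ E2 γ ∪ E3 γ) :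
    Continuous τ ∧ 0 < γ ∧ Tendsto (fun z => |τ z| / z ^ γ) atTop (𝓝 1) ∧
      ∃ ℓ, 0 ≤ ℓ ∧ Tendsto (fun z => |τ (-z)| / z ^ γ) atTop (𝓝 ℓ) ∧
        ∀ p : ℝ, 0 < p → (1 + ℓ ^ p) / 2 = cTau γ τ := by
  rcases h with h | h
  · have hneg := tendsto_neg_of_mem_E2 h
    refine ⟨h.1, h.2.1, h.2.2.1.congr' ?_, 1, zero_le_one, hneg, fun p _ => ?_⟩
    · filter_upwards [eventually_ge_atTop 0] with z hz
      rw [abs_of_nonneg hz]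
    -- The classes are disjoint because the left limits 1 and 0 conflict; `cTau` tests membership in
    -- `E3` only.
    · have h3 : τ ∉ E3 γ := fun h3 =>
        one_ne_zero (tendsto_nhds_unique hneg (tendsto_neg_of_mem_E3 h3))
      rw [cTau, if_neg h3, Real.one_rpow]
      norm_num
  · refine ⟨h.1, h.2.1, ?_, 0, le_rfl, tendsto_neg_of_mem_E3 h, fun p hp => ?_⟩
    · have h1 : Tendsto (fun z => τ z / z ^ γ) atTop (𝓝 1) := h.2.2.1
      have := h1.abs
      rw [abs_one] at this
      refine this.congr' ?_
      filter_upwards [eventually_gt_atTop 0] with z hz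
      rw [abs_div, abs_of_pos (Real.rpow_pos_of_pos hz γ)]
    · rw [cTau, if_pos h, Real.zero_rpow hp.ne', add_zero]

lemma cTau_pos (γ : ℝ) (τ : ℝ → ℝ) : 0 < cTau γ τ := by
  unfold cTau
  split_ifs <;> norm_num

lemma exists_ne_zero_of_tendsto (h : Tendsto (fun z => |τ z| / z ^ γ) atTop (𝓝 1)) :
    ∃ y, τ y ≠ 0 := by
  obtain ⟨y, hy⟩ := (h.eventually_const_lt one_pos).exists
  refine ⟨y, fun h0 => ?_⟩
  simp [h0] at hy

end Activation

end StableTail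

/-! ### The theorem: comparison of the two tail indices. -/

theorem theorem1 {Ω : Type*} [MeasurableSpace Ω] (P : Measure Ω) [IsProbabilityMeasure P]
    (X Y : Ω → ℝ) (αx αy σx σy : ℝ)
    (hX : StableTail.IsSymmStable P X αx σx) (hY : StableTail.IsSymmStable P Y αy σy)
    (hXY : IndepFun X Y P) (τ : ℝ → ℝ) :
    -- sub-linear activations
    (∀ β : ℝ, τ ∈ StableTail.E1 β → (∃ y, τ y ≠ 0) → β * αx < αy → αx < 2 →
      Integrable (fun ω => |τ (Y ω)| ^ αx) P ∧
      StableTail.AsympEq atTop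
        (StableTail.survival P (fun ω => |X ω * τ (Y ω)|))
        (fun t => StableTail.tailConst αx * σx ^ αx * (∫ ω, |τ (Y ω)| ^ αx ∂P) *
          t ^ (-αx))) ∧
    -- activations of exact polynomial growth `γ`
    (∀ γ : ℝ, τ ∈ StableTail.E2 γ ∪ StableTail.E3 γ →
      ∀ α : ℝ, α = min αx (αy / γ) →
      (αy / αx < γ → αy < 2 →
        Integrable (fun ω => |X ω| ^ α) P ∧
        StableTail.RegularlyVarying
          (StableTail.survival P (fun ω => |X ω * τ (Y ω)|)) (-α) ∧
        StableTail.AsympEq atTop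
          (StableTail.survival P (fun ω => |X ω * τ (Y ω)|))
          (fun z => StableTail.cTau γ τ * StableTail.tailConst (α * γ) * σy ^ (α * γ) *
            (∫ ω, |X ω| ^ α ∂P) * z ^ (-α))) ∧
      (γ = αy / αx → αx < 2 → αy < 2 →
        StableTail.RegularlyVarying
          (StableTail.survival P (fun ω => |X ω * τ (Y ω)|)) (-α) ∧
        StableTail.AsympEq atTop
          (StableTail.survival P (fun ω => |X ω * τ (Y ω)|))
          (fun z => StableTail.cTau γ τ * α * StableTail.tailConst α *
            StableTail.tailConst (α * γ) * σx ^ α * σy ^ (α * γ) *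
            z ^ (-α) * Real.log z)) ∧
      (γ < αy / αx → αx < 2 →
        Integrable (fun ω => |τ (Y ω)| ^ α) P ∧
        StableTail.RegularlyVarying
          (StableTail.survival P (fun ω => |X ω * τ (Y ω)|)) (-α) ∧
        StableTail.AsympEq atTop
          (StableTail.survival P (fun ω => |X ω * τ (Y ω)|))
          (fun z => StableTail.tailConst α * σx ^ α * (∫ ω, |τ (Y ω)| ^ α ∂P) *
            z ^ (-α)))) := by
  open StableTail in
  have hx0 := hX.index_pos
  have hy0 := hY.index_pos
  have hσx := hX.scale_pos
  have hσy := hY.scale_pos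
  have hmomX : ∀ q, 0 < q → q < αx → Integrable (fun ω => |X ω| ^ q) P :=
    fun q h1 h2 => hX.integrable_abs_rpow h1 h2
  have hmomY : ∀ q, 0 < q → q < αy → Integrable (fun ω => |Y ω| ^ q) P :=
    fun q h1 h2 => hY.integrable_abs_rpow h1 h2
  have hprod : (fun ω => |X ω * τ (Y ω)|) = fun ω => |X ω| * |τ (Y ω)| :=
    funext fun ω => abs_mul _ _
  have hprod' : (fun ω => |X ω * τ (Y ω)|) = fun ω => |τ (Y ω)| * |X ω| :=
    funext fun ω => by rw [abs_mul, mul_comm]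
  -- `X` has the heavier tail: Breiman's lemma with `W = |X|`. This serves both the sub-linear case
  -- and the case `γ < αy / αx`.
  have hlight : Continuous τ → (∃ y, τ y ≠ 0) → αx < 2 → ∀ b, 0 ≤ b → b * αx < αy →
      (fun z => |τ z|) =O[atTop] (fun z => z ^ b) →
      (fun z => |τ (-z)|) =O[atTop] (fun z => z ^ b) →
      Integrable (fun ω => |τ (Y ω)| ^ αx) P ∧
      RegularlyVarying (survival P (fun ω => |X ω * τ (Y ω)|)) (-αx) ∧
      AsympEq atTop (survival P (fun ω => |X ω * τ (Y ω)|))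
        (fun t => tailConst αx * σx ^ αx * (∫ ω, |τ (Y ω)| ^ αx ∂P) * t ^ (-αx)) := by
    intro hτ hne hx2 b hb hbα h₁ h₂
    have hint := integrable_abs_comp_rpow hY.measurable hτ hb hx0 hbα hmomY h₁ h₂
    have hpos := hY.integral_abs_comp_rpow_pos hτ hne hint
    have hcpos := tailConst_pos hx0 hx2
    refine ⟨hint, regularlyVarying_and_asympEq (by positivity) ?_⟩
    rw [hprod]
    exact tendsto_survival_mul_of_integrable hX.measurable.abs
      (hτ.measurable.comp hY.measurable).abs (fun ω => abs_nonneg _)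
      (hXY.comp measurable_abs hτ.measurable.abs) hx0 (hX.tendsto_survival_abs hx2) hint
  refine ⟨fun β hτ hne hβ hx2 => ?_, fun γ hτ α hα => ?_⟩
  · obtain ⟨h₁, h₂⟩ := isBigO_of_mem_E1 hτ
    obtain ⟨hint, -, has⟩ := hlight hτ.1 hne hx2 β hτ.2.1 hβ h₁ h₂
    exact ⟨hint, has⟩
  obtain ⟨hc, hγ, h₁, ℓ, hℓ, h₂, hcτ⟩ := exists_tendsto_of_mem_E2_union_E3 hτ
  have hne := exists_ne_zero_of_tendsto h₁
  have hcpos := cTau_pos γ τ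
  have hτm : Measurable fun ω => |τ (Y ω)| := (hc.measurable.comp hY.measurable).abs
  have hp : 0 < αy / γ := by positivity
  have htail : αy < 2 → Tendsto (fun s => s ^ (αy / γ) * survival P (fun ω => |τ (Y ω)|) s) atTop
      (𝓝 (cTau γ τ * (tailConst αy * σy ^ αy))) := fun hy2 => by
    rw [← hcτ _ hp]
    exact hY.tendsto_survival_abs_comp hy2 hc hγ hℓ h₁ h₂
  refine ⟨fun hlt hy2 => ?_, fun heq hx2 hy2 => ?_, fun hlt hx2 => ?_⟩
  -- Now `τ(Y)` is heavier, so the roles in Breiman's lemma are exchanged; only a moment of `X` of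
  -- order `αy / γ < αx` is needed, and `αx = 2` is allowed.
  · rw [div_lt_comm₀ hx0 hγ] at hlt
    rw [min_eq_right hlt.le] at hα
    subst hα
    rw [div_mul_cancel₀ _ hγ.ne']
    have hint := hmomX _ hp hlt
    have hpos := hX.integral_abs_comp_rpow_pos continuous_id ⟨1, one_ne_zero⟩ hint
    simp only [id] at hpos
    have hyc := tailConst_pos hy0 hy2
    refine ⟨hint, regularlyVarying_and_asympEq (by positivity) ?_⟩
    rw [hprod', mul_assoc (cTau γ τ)]
    exact tendsto_survival_mul_of_integrable hτm hX.measurable.abs (fun ω => abs_nonneg _)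
      (hXY.symm.comp hc.measurable.abs measurable_abs) hp (htail hy2) hint
  · have hγα : αy / γ = αx := by
      rw [heq]
      field_simp
    rw [hγα, min_self] at hα
    subst hα
    have hαγ : α * γ = αy := by
      rw [← hγα]
      field_simp
    rw [hαγ]
    have hyc := tailConst_pos hy0 hy2
    have hxc := tailConst_pos hx0 hx2
    have htail := htail hy2
    rw [hγα] at htail
    refine regularlyVarying_and_asympEq_log (by positivity) ?_
    rw [hprod]
    convert tendsto_survival_mul_div_log hX.measurable.abs hτm (fun ω => abs_nonneg _)
      (hXY.comp measurable_abs hc.measurable.abs) hx0 (hX.tendsto_survival_abs hx2) htail using 2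
    ring
  · have hlt' : αx < αy / γ := by
      rw [lt_div_iff₀ hγ, mul_comm]
      exact (lt_div_iff₀ hx0).1 hlt
    rw [min_eq_left hlt'.le] at hα
    subst hα
    exact hlight hc hne hx2 γ hγ.le ((lt_div_iff₀ hx0).1 hlt) (isBigO_rpow_of_tendsto h₁)
      (isBigO_rpow_of_tendsto h₂)
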